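/- **Setting.** Let $(X,\pi)$ be a weighted simplicial complex of rank $n$: $X$ is a downward closed family of subsets of a finite set (with $\varnothing\in X$), every face is contained in a face of size $n$, and $\pi$ is a probability distribution with full support on the set $X^{(n)}$ of faces of size $n$. Write $X^{(j)}$ for the faces of size $j$ and $\pi_j(\alpha)=\binom nj^{-1}\Pr_{\omega\sim\pi}[\omega\supseteq\alpha]$ for $\alpha\in X^{(j)}$. The link of $\alpha\in X$ is the weighted complex $(X_\alpha,\pi^{(\alpha)})$ of rank $n-|\alpha|$, where $X_\alpha=\{\beta\setminus\alpha:\alpha\subseteq\beta\in X\}$ and $\pi^{(\alpha)}(\tau)=\Pr_{\omega\sim\pi}[\omega=\alpha\cup\tau\mid\omega\supseteq\alpha]$; its level distributions are denoted $\pi^{(\alpha)}_k$. *Walks.* For $\ell\le k\le n$ let $$U_{\ell\to k}(\alpha,\tau)=\mathbf 1[\tau\supseteq\alpha]\,\frac{\Pr_{\omega\sim\pi}[\omega\supseteq\tau\mid\omega\supseteq\alpha]}{\binom{n-\ell}{k-\ell}},\qquad D_{k\to\ell}(\tau,\alpha)=\frac{\mathbf 1[\alpha\subseteq\tau]}{\binom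 k\ell},$$ and let $DU_{n\leftrightarrow\ell}=D_{n\to\ell}U_{\ell\to n}$ on $X^{(n)}$ and $UD_{n-1}=U_{n-1\to n}D_{n\to n-1}$ on $X^{(n-1)}$, with stationary distributions $\pi_n=\pi$ and $\pi_{n-1}$. For $|\alpha|\le n-2$ let $M_\alpha$ be the walk on $X_\alpha^{(1)}$ with $M_\alpha(x,x)=0$ and $M_\alpha(x,y)=\Pr_{\omega\sim\pi}[\omega\supseteq\alpha\cup\{x,y\}\mid\omega\supseteq\alpha\cup\{x\}]/(n-|\alpha|-1)$ for $x\ne y$; it is reversible with respect to $\pi_1^{(\alpha)}$. *Constants.* Put $\mathrm{Ent}_\mu(f)=\mathbb E_\mu[f\log f]-\mathbb E_\mu f\cdot\log\mathbb E_\mu f$ for $f\ge0$ (with $0\log 0=0$). For a walk $P$ reversible with respect to $\mu$, $$LS(P)=\inf_{f\ge0,\ \mathrm{Ent}_\mu(f^2)\neq0}\frac{\langle f,(I-P)f\rangle_\mu}{\mathrm{Ent}_\mu(f^2)}\in[0,+\infty],\qquad \mathrm{Gap}(P)=\min_{\mathrm{Var}_\mu(f)\ne0}\frac{\langle f,(I-P)f\rangle_\mu}{\mathrm{Var}_\mu(f)},$$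 with $\inf\varnothing=+\infty$. For $\ell\le k\le n$, $$EC(U_{\ell\to k})=1-\sup_{f\ge0,\ \mathrm{Ent}_{\pi_k}(f)\neq0}\frac{\mathrm{Ent}_{\pi_\ell}(U_{\ell\to k}f)}{\mathrm{Ent}_{\pi_k}(f)},$$ and for $|\alpha|<n$, with $n'=n-|\alpha|$ and $U_{\alpha,1\to n'}$ the up-walk of the link of $\alpha$, $$\mathrm{lec}(\alpha)=\sup_{g\ge0,\ \mathrm{Ent}_{\pi^{(\alpha)}_{n'}}(g)\ne0}\frac{\mathrm{Ent}_{\pi_1^{(\alpha)}}(U_{\alpha,1\to n'}g)}{\mathrm{Ent}_{\pi_{n'}^{(\alpha)}}(g)},\qquad \mathrm{lec}_i(X,\pi)=\max_{\alpha\in X^{(i)}}\mathrm{lec}(\alpha),$$ where suprema over the empty set are $0$. Finally let $\pi^\star_{\alpha,k}=\min_{\tau\in X_\alpha^{(k)}}\pi_k^{(\alpha)}(\tau)$, $\mathrm{Gap}_{n-2}(X,\pi)=\min_{\alpha\in X^{(n-2)}}\mathrm{Gap}(M_\alpha)$, $C_{\ell,k}=\min_{\alpha\in X^{(\ell)}}C_{\alpha,k}$,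 and $$C_{\alpha,k}=\begin{cases}1,&\pi^\star_{\alpha,k}>1/2,\\ 1/2,&\pi^\star_{\alpha,k}=1/2,\\ \dfrac{1-2\pi^\star_{\alpha,k}}{\log\left((\pi^\star_{\alpha,k})^{-1}-1\right)},&\pi^\star_{\alpha,k}<1/2.\end{cases}$$ **Statement.** For every $0\le\ell\le n$, $$LS(DU_{n\leftrightarrow\ell})\ \ge\ \min_{\omega\in X^{(\ell)}}C_{\omega,n-\ell}\cdot EC(U_{\ell\to n}).$$ If $n\ge2$, then $$LS(UD_{n-1})\ \ge\ \frac{n-1}{n}\cdot\min_{\omega\in X^{(n-2)}}C_{\omega,1}\cdot\mathrm{Gap}_{n-2}(X,\pi)\cdot EC(U_{n-2\to n-1}).$$ In particular, for every $0\le\ell\le n$, $$LS(DU_{n\leftrightarrow\ell})\ \ge\ C_{\ell,n-\ell}\cdot\prod_{i=0}^{\ell-1}\bigl(1-\mathrm{lec}_i(X,\pi)\bigr).$$ -/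

import Mathlib

noncomputable section

open Finset

/-! ## Functional inequalities on finite probability spaces -/

namespace FinProb

/-- The expectation `E_μ f = ∑ μ(x) f(x)`. -/
def expect {Ω : Type*} [Fintype Ω] (μ f : Ω → ℝ) : ℝ := ∑ x, μ x * f x

/-- The entropy `Ent_μ(f) = E_μ[f log f] - (E_μ f) log (E_μ f)`, for `f ≥ 0` (`0 log 0 = 0`). -/
def ent {Ω : Type*} [Fintype Ω] (μ f : Ω → ℝ) : ℝ :=
  expect μ (fun x => f x * Real.log (f x)) - expect μ f * Real.log (expect μ f)

/-- The variance `Var_μ(f) = E_μ[f²] - (E_μ f)²`. -/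
def var {Ω : Type*} [Fintype Ω] (μ f : Ω → ℝ) : ℝ :=
  expect μ (fun x => f x ^ 2) - expect μ f ^ 2

/-- The Dirichlet form `⟨f, (I - P) f⟩_μ`. -/
def dirichlet {Ω : Type*} [Fintype Ω] (μ : Ω → ℝ) (P : Matrix Ω Ω ℝ) (f : Ω → ℝ) : ℝ :=
  expect μ (fun x => f x * (f x - P.mulVec f x))

/-- The log-Sobolev constant `LS(P)`: the infimum of `⟨f, (I - P) f⟩_μ / Ent_μ(f²)` over all
`f ≥ 0` with `Ent_μ(f²) ≠ 0`. It is an extended real: on a one-point space no `f` is admissible,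
and the infimum over the empty set is `+∞`. -/
def logSobolev {Ω : Type*} [Fintype Ω] (μ : Ω → ℝ) (P : Matrix Ω Ω ℝ) : EReal :=
  sInf {r : EReal | ∃ f : Ω → ℝ, (∀ x, 0 ≤ f x) ∧ ent μ (fun x => f x ^ 2) ≠ 0 ∧
    r = ((dirichlet μ P f / ent μ (fun x => f x ^ 2) : ℝ) : EReal)}

/-- The spectral gap `min { ⟨f, (I - P) f⟩_μ / Var_μ(f) : Var_μ(f) ≠ 0 }`. -/
def gap {Ω : Type*} [Fintype Ω] (μ : Ω → ℝ) (P : Matrix Ω Ω ℝ) : ℝ :=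
  sInf {r : ℝ | ∃ f : Ω → ℝ, var μ f ≠ 0 ∧ r = dirichlet μ P f / var μ f}

/-- The supremum of `Ent_{μ₁}(P f) / Ent_{μ₂}(f)` over all `f ≥ 0` with `Ent_{μ₂}(f) ≠ 0`, for a
row-stochastic `P` with `μ₁ P = μ₂`. By the data processing inequality these ratios lie in `[0, 1]`;
the supremum over the empty set (when `μ₂` lives on one point) is `0`. -/
def entRatio {Ω₁ Ω₂ : Type*} [Fintype Ω₁] [Fintype Ω₂] (μ₁ : Ω₁ → ℝ) (μ₂ : Ω₂ → ℝ)
    (P : Matrix Ω₁ Ω₂ ℝ) : ℝ :=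
  sSup {r : ℝ | ∃ f : Ω₂ → ℝ, (∀ x, 0 ≤ f x) ∧ ent μ₂ f ≠ 0 ∧
    r = ent μ₁ (P.mulVec f) / ent μ₂ f}

/-- The entropy contraction constant `EC(P)`. -/
def entContraction {Ω₁ Ω₂ : Type*} [Fintype Ω₁] [Fintype Ω₂] (μ₁ : Ω₁ → ℝ) (μ₂ : Ω₂ → ℝ)
    (P : Matrix Ω₁ Ω₂ ℝ) : ℝ :=
  1 - entRatio μ₁ μ₂ P

end FinProb

/-- A weighted simplicial complex `(X, π)` of rank `n`: a downward closed collection of finite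
subsets of `U` (the empty face included), pure of rank `n`, with a probability distribution `π` of
full support on the faces of size `n`. The values of `weight` off the faces of size `n` are
irrelevant. -/
structure WeightedComplex (U : Type*) [DecidableEq U] (n : ℕ) where
  faces : Finset (Finset U)
  down_closed : ∀ β ∈ faces, ∀ α, α ⊆ β → α ∈ faces
  pure : ∀ α ∈ faces, ∃ β ∈ faces, α ⊆ β ∧ β.card = n
  weight : Finset U → ℝ
  weight_pos : ∀ β ∈ faces, β.card = n → 0 < weight β
  weight_sum : ∑ β ∈ faces with β.card = n, weight β = 1

namespace WeightedComplex

variable {U : Type*} [DecidableEq U] {n : ℕ}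

/-- `X^{(j)}`: the faces of size `j`. -/
abbrev Face (X : WeightedComplex U n) (j : ℕ) : Type _ :=
  {α : Finset U // α ∈ X.faces.filter (fun α => α.card = j)}

/-- `Pr_{ω ∼ π}[ω ⊇ α]`. -/
def prob (X : WeightedComplex U n) (α : Finset U) : ℝ :=
  ∑ β ∈ X.faces with β.card = n ∧ α ⊆ β, X.weight β

theorem face_mem (X : WeightedComplex U n) {j : ℕ} (α : X.Face j) : α.1 ∈ X.faces :=
  (mem_filter.mp α.2).1

theorem prob_pos (X : WeightedComplex U n) {α : Finset U} (hα : α ∈ X.faces) : 0 < X.prob α := by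
  obtain ⟨β, hβ, hαβ, hc⟩ := X.pure α hα
  refine sum_pos (fun γ hγ => ?_) ⟨β, by simp [hβ, hαβ, hc]⟩
  simp only [mem_filter] at hγ
  exact X.weight_pos γ hγ.1 hγ.2.1

/-- The distribution `π_j` on `X^{(j)}`: draw `ω ∼ π` and output a uniformly random subset of `ω` of
size `j`. -/
def level (X : WeightedComplex U n) (j : ℕ) (α : X.Face j) : ℝ :=
  X.prob α.1 / (n.choose j : ℝ)

/-- The link `(X_α, π^{(α)})` of a face `α`, of rank `n - |α|`:
`X_α = {β \ α : β ∈ X, β ⊇ α}` and `π^{(α)}(τ) = π(α ∪ τ) / Pr_{ω ∼ π}[ω ⊇ α]`. -/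
def link (X : WeightedComplex U n) (α : Finset U) (hα : α ∈ X.faces) :
    WeightedComplex U (n - α.card) where
  faces := (X.faces.filter (fun β => α ⊆ β)).image (fun β => β \ α)
  down_closed := by
    intro τ hτ σ hσ
    simp only [mem_image, mem_filter] at hτ ⊢
    obtain ⟨β, ⟨hβ, hαβ⟩, rfl⟩ := hτ
    have hd : Disjoint σ α := disjoint_of_subset_left hσ sdiff_disjoint
    refine ⟨σ ∪ α, ⟨X.down_closed β hβ _ ?_, subset_union_right⟩, ?_⟩
    · exact union_subset (hσ.trans sdiff_subset) hαβ
    · rw [union_sdiff_right, sdiff_eq_self_of_disjoint hd]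
  pure := by
    intro τ hτ
    simp only [mem_image, mem_filter] at hτ ⊢
    obtain ⟨β, ⟨hβ, hαβ⟩, rfl⟩ := hτ
    obtain ⟨γ, hγ, hβγ, hc⟩ := X.pure β hβ
    refine ⟨γ \ α, ⟨γ, ⟨hγ, hαβ.trans hβγ⟩, rfl⟩, sdiff_subset_sdiff hβγ subset_rfl, ?_⟩
    rw [card_sdiff_of_subset (hαβ.trans hβγ), hc]
  weight := fun τ => X.weight (α ∪ τ) / X.prob α
  weight_pos := by
    intro τ hτ hc
    simp only [mem_image, mem_filter] at hτ
    obtain ⟨β, ⟨hβ, hαβ⟩, rfl⟩ := hτ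
    refine div_pos (X.weight_pos _ ?_ ?_) (X.prob_pos hα)
    · rwa [union_sdiff_of_subset hαβ]
    · rw [union_sdiff_of_subset hαβ]
      obtain ⟨γ, -, hβγ, hγ⟩ := X.pure β hβ
      have h1 := card_le_card hβγ
      have h2 := card_le_card hαβ
      rw [card_sdiff_of_subset hαβ] at hc
      omega
  weight_sum := by
    rw [← sum_div, div_eq_one_iff_eq (X.prob_pos hα).ne', prob]
    obtain ⟨γ, -, hαγ, hγ⟩ := X.pure α hα
    have h1 := card_le_card hαγ
    symm
    refine sum_bij' (fun β _ => β \ α) (fun τ _ => α ∪ τ) ?_ ?_ ?_ ?_ ?_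
    · intro β hβ
      simp only [mem_filter, mem_image] at hβ ⊢
      exact ⟨⟨β, ⟨hβ.1, hβ.2.2⟩, rfl⟩, by rw [card_sdiff_of_subset hβ.2.2, hβ.2.1]⟩
    · intro τ hτ
      simp only [mem_filter, mem_image] at hτ ⊢
      obtain ⟨⟨β, ⟨hβ, hαβ⟩, rfl⟩, hc⟩ := hτ
      have h2 := card_le_card hαβ
      rw [card_sdiff_of_subset hαβ] at hc
      rw [union_sdiff_of_subset hαβ]
      obtain ⟨δ, -, hβδ, hδ⟩ := X.pure β hβ
      have h3 := card_le_card hβδ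
      exact ⟨hβ, by omega, hαβ⟩
    · intro β hβ
      simp only [mem_filter] at hβ
      exact union_sdiff_of_subset hβ.2.2
    · intro τ hτ
      simp only [mem_filter, mem_image] at hτ
      obtain ⟨⟨β, ⟨hβ, hαβ⟩, rfl⟩, hc⟩ := hτ
      rw [union_sdiff_of_subset hαβ]
    · intro β hβ
      simp only [mem_filter] at hβ
      rw [union_sdiff_of_subset hβ.2.2]

/-- The link of a face of size `j`. -/
abbrev linkAt (X : WeightedComplex U n) {j : ℕ} (α : X.Face j) :
    WeightedComplex U (n - α.1.card) :=
  X.link α.1 (X.face_mem α)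

/-- The up-walk `U_{ℓ → k}`:
`U(α, τ) = 1[τ ⊇ α] Pr[ω ⊇ τ | ω ⊇ α] / binom(n - ℓ, k - ℓ)`. -/
def up (X : WeightedComplex U n) (ℓ k : ℕ) : Matrix (X.Face ℓ) (X.Face k) ℝ :=
  fun α τ => if α.1 ⊆ τ.1 then
    X.prob τ.1 / X.prob α.1 / ((n - ℓ).choose (k - ℓ) : ℝ) else 0

/-- The down-walk `D_{k → ℓ}`: `D(τ, α) = 1[α ⊆ τ] / binom(k, ℓ)`. -/
def down (X : WeightedComplex U n) (k ℓ : ℕ) : Matrix (X.Face k) (X.Face ℓ) ℝ :=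
  fun τ α => if α.1 ⊆ τ.1 then 1 / (k.choose ℓ : ℝ) else 0

/-- The down-up walk `DU_{n ↔ ℓ}` on `X^{(n)}`: move from `ω` to a uniformly random subset `α` of
size `ℓ`, then sample from `π` conditioned on containing `α`. -/
def downUp (X : WeightedComplex U n) (ℓ : ℕ) : Matrix (X.Face n) (X.Face n) ℝ :=
  X.down n ℓ * X.up ℓ n

/-- The up-down walk `UD_{ℓ ↔ n}` on `X^{(ℓ)}`: sample `ω ∼ π` conditioned on containing the current
face, then move to a uniformly random subset of `ω` of size `ℓ`. -/
def upDown (X : WeightedComplex U n) (ℓ : ℕ) : Matrix (X.Face ℓ) (X.Face ℓ) ℝ :=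
  X.up ℓ n * X.down n ℓ

/-- The random walk on the vertices of a complex of rank `n ≥ 2`, for `x ≠ y`
`M(x, y) = Pr[ω ⊇ {x, y} | ω ⊇ {x}] / (n - 1)`, and `M(x, x) = 0`. -/
def vertexWalk (X : WeightedComplex U n) : Matrix (X.Face 1) (X.Face 1) ℝ :=
  fun x y => if x = y then 0 else X.prob (x.1 ∪ y.1) / X.prob x.1 / ((n : ℝ) - 1)

/-- The spectral gap of the link graph `M_α`, which is reversible with respect to
`π_1^{(α)}`. -/
def linkGap (X : WeightedComplex U n) {j : ℕ} (α : X.Face j) : ℝ :=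
  FinProb.gap ((X.linkAt α).level 1) (X.linkAt α).vertexWalk

/-- `Gap_j(X, π)`: the minimum of the spectral gaps of the link graphs of the faces of size `j`. -/
def minGap (X : WeightedComplex U n) (j : ℕ) : ℝ := ⨅ α : X.Face j, X.linkGap α

/-- The entropy contraction constant `EC(U_{ℓ → k})`, with respect to `π_ℓ` and `π_k`. -/
def upEC (X : WeightedComplex U n) (ℓ k : ℕ) : ℝ :=
  FinProb.entContraction (X.level ℓ) (X.level k) (X.up ℓ k)

/-- The local entropy contraction factor `lec(α)`: the supremum of
`Ent_{π_1^{(α)}}(U_{α, 1 → n'} g) / Ent_{π_{n'}^{(α)}}(g)`, where `n' = n - |α|`. -/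
def lec (X : WeightedComplex U n) {j : ℕ} (α : X.Face j) : ℝ :=
  FinProb.entRatio ((X.linkAt α).level 1) ((X.linkAt α).level (n - α.1.card))
    ((X.linkAt α).up 1 (n - α.1.card))

/-- `lec_i(X, π)`: the largest local entropy contraction factor of a face of size `i`. -/
def maxLec (X : WeightedComplex U n) (i : ℕ) : ℝ := ⨆ α : X.Face i, X.lec α

/-- The function `p ↦ (1 - 2 p) / log (p⁻¹ - 1)` on `(0, 1/2)`, with its limit value `1/2` at
`p = 1/2`, and `1` for `p > 1/2`. -/
def lsFun (p : ℝ) : ℝ :=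
  if 1 / 2 < p then 1 else if p = 1 / 2 then 1 / 2 else (1 - 2 * p) / Real.log (p⁻¹ - 1)

/-- `π^⋆_{α, k}`: the minimum of `π_k^{(α)}` over the faces of size `k` of the link of `α`. -/
def minLinkProb (X : WeightedComplex U n) {j : ℕ} (α : X.Face j) (k : ℕ) : ℝ :=
  ⨅ τ : (X.linkAt α).Face k, (X.linkAt α).level k τ

/-- `C_{j, k}`: the minimum over the faces `α` of size `j` of the constants `C_{α, k}`. -/
def minC (X : WeightedComplex U n) (j k : ℕ) : ℝ := ⨅ α : X.Face j, lsFun (X.minLinkProb α k)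

end WeightedComplex

end

/-! Everything rests on sandwiching the average entropy of `f²` conditioned on a random face of size
`ℓ`. From below, the chain rule `ent_chain` splits the entropy of `f²` at level `k` into this
average plus the entropy of `U_{ℓ→k} f²`, so the average is at least `EC(U_{ℓ→k})` times the full
entropy. From above, conditioning on `α` produces a level distribution of the link of `α`, where the
log-Sobolev inequality of the complete graph (`lsDefect_nonneg`) bounds the constant times entropy
by variance.

The averaged conditional variance is exactly the Dirichlet form of the down-up walk
(`dirichlet_downUp`), which resamples from the conditional distribution. For the up-down walk on
faces of size `n - 1`, the conditional variances are bounded through the gaps of the link graphs,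
whose Dirichlet forms average to that of the walk up to the factor `(n - 1) / n`
(`expect_dirichlet_link`): two distinct faces of size `n - 1` with a common top face share exactly
one face of size `n - 2`. The product bound applies the chain rule one added element at a time
(`prod_mul_ent_le_avgEnt`).

For the complete graph, minimize the degree-two homogeneous defect `Var(f) - c Ent(f²)` over
nonnegative `f` with `E f² = 1`. A minimizer is strictly positive, and its Euler-Lagrange equation
has at most two positive roots, so it takes at most two values. This leaves a two-point space `{q, 1
- q}`, where the defect in the ratio `t` of the values has double zeros at `1` and `(1 - q) / q`,
which forces nonnegativity (`nonneg_of_double_touch`). Monotonicity of the constant (`lsFun_mono`)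
passes from `q` to the smallest mass. -/

noncomputable section

open Finset

/-! ### The two-point log-Sobolev inequality: one-variable calculus -/

/-- A function on `(0, ∞)` that touches `0` with horizontal tangent at `1` and at `T > 1`, and whose
derivative is controlled by a quadratic polynomial, is nonnegative. -/
theorem nonneg_of_double_touch {F G u v : ℝ → ℝ} {A B C T : ℝ} (hA : 0 < A)
    (hF : ∀ t, 0 < t → HasDerivAt F (u t * G t) t) (hu : ∀ t, 0 < t → 0 < u t)
    (hG : ∀ t, 0 < t → HasDerivAt G (v t * (A * t ^ 2 + B * t + C)) t)
    (hv : ∀ t, 0 < t → 0 < v t) (hT : 1 < T)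
    (hF1 : F 1 = 0) (hFT : F T = 0) (hG1 : G 1 = 0) (hGT : G T = 0) {t : ℝ} (ht : 0 < t) :
    0 ≤ F t := by
  have hFc : ∀ t, 0 < t → ContinuousAt F t := fun t h => (hF t h).continuousAt
  have hGc : ∀ t, 0 < t → ContinuousAt G t := fun t h => (hG t h).continuousAt
  -- Rolle for `F` gives a third zero `s` of `G` between `1` and `T`; Rolle for `G` on both sides of
  -- `s` then locates both roots of the quadratic.
  obtain ⟨s, hs, hs0⟩ := exists_hasDerivAt_eq_zero hT
    (fun x hx => (hFc x (by linarith [hx.1])).continuousWithinAt) (by rw [hF1, hFT])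
    (fun x hx => hF x (by linarith [hx.1]))
  have hGs : G s = 0 := by
    rcases mul_eq_zero.mp hs0 with h | h
    · exact absurd h (hu s (by linarith [hs.1])).ne'
    · exact h
  obtain ⟨r₁, hr₁, h₁⟩ := exists_hasDerivAt_eq_zero hs.1
    (fun x hx => (hGc x (by linarith [hx.1])).continuousWithinAt) (by rw [hG1, hGs])
    (fun x hx => hG x (by linarith [hx.1]))
  obtain ⟨r₂, hr₂, h₂⟩ := exists_hasDerivAt_eq_zero hs.2
    (fun x hx => (hGc x (by linarith [hx.1, hs.1])).continuousWithinAt) (by rw [hGT, hGs])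
    (fun x hx => hG x (by linarith [hx.1, hs.1]))
  obtain ⟨hs1, hsT⟩ := hs
  obtain ⟨hr₁l, hr₁r⟩ := hr₁
  obtain ⟨hr₂l, hr₂r⟩ := hr₂
  have q₁ := (mul_eq_zero.mp h₁).resolve_left (hv r₁ (by linarith)).ne'
  have q₂ := (mul_eq_zero.mp h₂).resolve_left (hv r₂ (by linarith)).ne'
  have hB : A * (r₁ + r₂) + B = 0 := by
    have : (r₁ - r₂) * (A * (r₁ + r₂) + B) = 0 := by linear_combination q₁ - q₂
    exact (mul_eq_zero.mp this).resolve_left (by linarith)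
  have hQ : ∀ t, A * t ^ 2 + B * t + C = A * ((t - r₁) * (t - r₂)) := by
    intro t
    linear_combination (t - r₁) * hB + q₁
  have mono : ∀ {H H' : ℝ → ℝ} {a b : ℝ}, (∀ t, 0 < t → HasDerivAt H (H' t) t) → 0 < a → a ≤ b →
      (∀ x, a ≤ x → x ≤ b → 0 ≤ H' x) → H a ≤ H b := by
    intro H H' a b hH ha hab h
    refine monotoneOn_of_deriv_nonneg (convex_Icc a b)
      (fun x hx => (hH x (by linarith [hx.1])).continuousAt.continuousWithinAt)
      (fun x hx => ?_) (fun x hx => ?_) ⟨le_rfl, hab⟩ ⟨hab, le_rfl⟩ hab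
    all_goals rw [interior_Icc] at hx
    · exact (hH x (by linarith [hx.1])).differentiableAt.differentiableWithinAt
    · rw [(hH x (by linarith [hx.1])).deriv]
      exact h x hx.1.le hx.2.le
  have anti : ∀ {H H' : ℝ → ℝ} {a b : ℝ}, (∀ t, 0 < t → HasDerivAt H (H' t) t) → 0 < a → a ≤ b →
      (∀ x, a ≤ x → x ≤ b → H' x ≤ 0) → H b ≤ H a := by
    intro H H' a b hH ha hab h
    have := mono (H := fun x => -H x) (H' := fun x => -H' x) (fun t ht => (hH t ht).neg) ha hab
      (fun x h1 h2 => neg_nonneg.mpr (h x h1 h2))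
    linarith
  have Gup₁ : ∀ {a b}, 0 < a → a ≤ b → b ≤ r₁ → G a ≤ G b := fun ha hab hb =>
    mono hG ha hab fun x h1 h2 => by
      rw [hQ]
      exact mul_nonneg (hv x (by linarith)).le
        (mul_nonneg hA.le (mul_nonneg_of_nonpos_of_nonpos (by linarith) (by linarith)))
  have Gdown : ∀ {a b}, r₁ ≤ a → a ≤ b → b ≤ r₂ → G b ≤ G a := fun ha hab hb =>
    anti hG (by linarith) hab fun x h1 h2 => by
      rw [hQ]
      exact mul_nonpos_of_nonneg_of_nonpos (hv x (by linarith)).le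
        (mul_nonpos_of_nonneg_of_nonpos hA.le
          (mul_nonpos_of_nonneg_of_nonpos (by linarith) (by linarith)))
  have Gup₂ : ∀ {a b}, r₂ ≤ a → a ≤ b → G a ≤ G b := fun ha hab =>
    mono hG (by linarith) hab fun x h1 h2 => by
      rw [hQ]
      exact mul_nonneg (hv x (by linarith)).le
        (mul_nonneg hA.le (mul_nonneg (by linarith) (by linarith)))
  -- The signs of `G` on `(0, 1)`, `(1, s)`, `(s, T)`, `(T, ∞)` are `-`, `+`, `-`, `+`, so `F` is
  -- smallest at `1` and `T`, where it vanishes.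
  rcases le_total t 1 with h | h
  · rw [← hF1]
    refine anti hF ht h fun x h1 h2 => ?_
    have : G x ≤ 0 := hG1 ▸ Gup₁ (by linarith) h2 hr₁l.le
    exact mul_nonpos_of_nonneg_of_nonpos (hu x (by linarith)).le this
  rcases le_total t s with h' | h'
  · rw [← hF1]
    refine mono hF one_pos h fun x h1 h2 => mul_nonneg (hu x (by linarith)).le ?_
    rcases le_total x r₁ with h3 | h3
    · exact hG1 ▸ Gup₁ one_pos h1 h3
    · exact hGs ▸ Gdown h3 (by linarith) hr₂l.le
  rcases le_total t T with h'' | h''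
  · rw [← hFT]
    refine anti hF ht h'' fun x h1 h2 => mul_nonpos_of_nonneg_of_nonpos (hu x (by linarith)).le ?_
    rcases le_total x r₂ with h3 | h3
    · exact hGs ▸ Gdown (by linarith) (by linarith) h3
    · exact hGT ▸ Gup₂ h3 h2
  · rw [← hFT]
    refine mono hF (by linarith) h'' fun x h1 h2 => mul_nonneg (hu x (by linarith)).le ?_
    exact hGT ▸ Gup₂ hr₂r.le h1

/-- The defect of the log-Sobolev inequality with constant `K` on the two-point space `{q, 1 - q}`,
for the function with values `t` and `1`. -/
def twoPointDefect (K q t : ℝ) : ℝ :=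
  K * q * (1 - q) * (t - 1) ^ 2 - q * t ^ 2 * (2 * Real.log t) +
    (q * t ^ 2 + (1 - q)) * Real.log (q * t ^ 2 + (1 - q))

/-- The logarithmic part of the derivative of `twoPointDefect`. -/
def twoPointSlope (K q t : ℝ) : ℝ :=
  K * (1 - q) * (1 - t⁻¹) - 2 * Real.log t + Real.log (q * t ^ 2 + (1 - q))

theorem hasDerivAt_twoPointDefect (K : ℝ) {q t : ℝ} (hq : 0 < q) (hq1 : q < 1) (ht : 0 < t) :
    HasDerivAt (twoPointDefect K q) (2 * q * t * twoPointSlope K q t) t := by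
  have hm : 0 < q * t ^ 2 + (1 - q) := by nlinarith [mul_pos hq (pow_pos ht 2)]
  have h1 : HasDerivAt (fun t : ℝ => q * t ^ 2 + (1 - q)) (q * (2 * t)) t := by
    simpa using ((hasDerivAt_pow 2 t).const_mul q).add_const (1 - q)
  have h2 : HasDerivAt (fun t : ℝ => (t - 1) ^ 2) (2 * (t - 1)) t := by
    simpa using ((hasDerivAt_id' t).sub_const 1).fun_pow 2
  have h3 : HasDerivAt (fun t : ℝ => q * t ^ 2) (q * (2 * t)) t := by
    simpa using ((hasDerivAt_pow 2 t).const_mul q)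
  have h4 := (Real.hasDerivAt_log ht.ne').const_mul 2
  have := ((h2.const_mul (K * q * (1 - q))).sub (h3.mul h4)).add (h1.mul (h1.log hm.ne'))
  refine this.congr_deriv ?_
  unfold twoPointSlope
  field_simp
  ring

theorem hasDerivAt_twoPointSlope (K : ℝ) {q t : ℝ} (hq : 0 < q) (hq1 : q < 1) (ht : 0 < t) :
    HasDerivAt (twoPointSlope K q)
      ((1 - q) / (t ^ 2 * (q * t ^ 2 + (1 - q))) * (K * q * t ^ 2 + (-2) * t + K * (1 - q))) t := by
  have hm : 0 < q * t ^ 2 + (1 - q) := by nlinarith [mul_pos hq (pow_pos ht 2)]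
  have h1 : HasDerivAt (fun t : ℝ => q * t ^ 2 + (1 - q)) (q * (2 * t)) t := by
    simpa using ((hasDerivAt_pow 2 t).const_mul q).add_const (1 - q)
  have := ((((hasDerivAt_inv ht.ne').const_sub 1).const_mul (K * (1 - q))).sub
    ((Real.hasDerivAt_log ht.ne').const_mul 2)).add (h1.log hm.ne')
  refine this.congr_deriv ?_
  field_simp
  ring

theorem log_inv_sub_one_pos {q : ℝ} (hq : 0 < q) (hq2 : q < 1 / 2) : 0 < Real.log (q⁻¹ - 1) := by
  refine Real.log_pos ?_
  have : 2 < q⁻¹ := by rw [lt_inv_comm₀ two_pos hq]; linarith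
  linarith

/-- At `T = q⁻¹ - 1` one has `q T² + (1 - q) = T`, so every logarithm becomes a multiple of `log T`;
this value of `K` makes the defect and its slope vanish there as well as at `1`. -/
theorem twoPointDefect_nonneg {q t : ℝ} (hq : 0 < q) (hq2 : q < 1 / 2) (ht : 0 < t) :
    0 ≤ twoPointDefect (Real.log (q⁻¹ - 1) / (1 - 2 * q)) q t := by
  set L := Real.log (q⁻¹ - 1) with hL
  have hLpos : 0 < L := log_inv_sub_one_pos hq hq2
  have hd : 0 < 1 - 2 * q := by linarith
  have hT : 1 < q⁻¹ - 1 := by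
    have : 2 < q⁻¹ := by rw [lt_inv_comm₀ two_pos hq]; linarith
    linarith
  have hm : q * (q⁻¹ - 1) ^ 2 + (1 - q) = q⁻¹ - 1 := by field_simp; ring
  have hK : 0 < L / (1 - 2 * q) := div_pos hLpos hd
  refine nonneg_of_double_touch (u := fun t => 2 * q * t) (G := twoPointSlope (L / (1 - 2 * q)) q)
    (v := fun t => (1 - q) / (t ^ 2 * (q * t ^ 2 + (1 - q)))) (T := q⁻¹ - 1)
    (mul_pos hK hq)
    (fun t ht => hasDerivAt_twoPointDefect _ hq (by linarith) ht) (fun t ht => by positivity)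
    (fun t ht => hasDerivAt_twoPointSlope _ hq (by linarith) ht) (fun t ht => ?_) hT
    ?_ ?_ ?_ ?_ ht
  · have : 0 < 1 - q := by linarith
    positivity
  · simp [twoPointDefect]
  · rw [twoPointDefect, hm, ← hL]
    field_simp
    ring
  · simp [twoPointSlope]
  · rw [twoPointSlope, hm, ← hL]
    have : q⁻¹ - 1 = (1 - q) / q := by field_simp
    rw [this]
    have : 1 - q ≠ 0 := by linarith
    field_simp
    ring

/-- The two touching points merge at `q = 1/2`: the quadratic becomes `(t - 1)²`, so the slope is
monotone and changes sign only at `1`. -/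
theorem twoPointDefect_half_nonneg {t : ℝ} (ht : 0 < t) : 0 ≤ twoPointDefect 2 (1 / 2) t := by
  have hF : ∀ t : ℝ, 0 < t → _ := fun t ht =>
    hasDerivAt_twoPointDefect 2 (q := 1 / 2) (by norm_num) (by norm_num) ht
  have hG : ∀ t : ℝ, 0 < t → _ := fun t ht =>
    hasDerivAt_twoPointSlope 2 (q := 1 / 2) (by norm_num) (by norm_num) ht
  have hmono : MonotoneOn (twoPointSlope 2 (1 / 2)) (Set.Ioi 0) := by
    refine monotoneOn_of_deriv_nonneg (convex_Ioi 0)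
      (fun x hx => (hG x hx).continuousAt.continuousWithinAt) (fun x hx => ?_) (fun x hx => ?_)
    all_goals rw [interior_Ioi] at hx
    · exact (hG x hx).differentiableAt.differentiableWithinAt
    · rw [(hG x hx).deriv]
      refine mul_nonneg (by norm_num; positivity) ?_
      nlinarith [sq_nonneg (x - 1)]
  have hG1 : twoPointSlope 2 (1 / 2) 1 = 0 := by norm_num [twoPointSlope]
  have hF1 : twoPointDefect 2 (1 / 2) 1 = 0 := by norm_num [twoPointDefect]
  rw [← hF1]
  rcases le_total t 1 with h | h
  · refine antitoneOn_of_deriv_nonpos (convex_Icc t 1)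
      (fun x hx => (hF x (ht.trans_le hx.1)).continuousAt.continuousWithinAt)
      (fun x hx => ?_) (fun x hx => ?_) ⟨le_rfl, h⟩ ⟨h, le_rfl⟩ h
    all_goals
      rw [interior_Icc] at hx
      have hx0 : 0 < x := ht.trans hx.1
    · exact (hF x hx0).differentiableAt.differentiableWithinAt
    · rw [(hF x hx0).deriv]
      refine mul_nonpos_of_nonneg_of_nonpos (by positivity) ?_
      rw [← hG1]
      exact hmono hx0 (Set.mem_Ioi.mpr one_pos) hx.2.le
  · refine monotoneOn_of_deriv_nonneg (convex_Icc 1 t)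
      (fun x hx => (hF x (one_pos.trans_le hx.1)).continuousAt.continuousWithinAt)
      (fun x hx => ?_) (fun x hx => ?_) ⟨le_rfl, h⟩ ⟨h, le_rfl⟩ h
    all_goals
      rw [interior_Icc] at hx
      have hx0 : 0 < x := one_pos.trans hx.1
    · exact (hF x hx0).differentiableAt.differentiableWithinAt
    · rw [(hF x hx0).deriv]
      refine mul_nonneg (by positivity) ?_
      rw [← hG1]
      exact hmono (Set.mem_Ioi.mpr one_pos) hx0 hx.1.le

/-! ### The log-Sobolev constant as a function of the smallest mass -/

open WeightedComplex in
theorem lsFun_of_lt {p : ℝ} (hp : p < 1 / 2) : lsFun p = (1 - 2 * p) / Real.log (p⁻¹ - 1) := by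
  rw [lsFun, if_neg (by linarith), if_neg (by linarith)]

open WeightedComplex in
theorem lsFun_half : lsFun (1 / 2) = 1 / 2 := by simp [lsFun]

open WeightedComplex in
theorem lsFun_pos {p : ℝ} (hp : 0 < p) : 0 < lsFun p := by
  rcases lt_trichotomy p (1 / 2) with h | h | h
  · rw [lsFun_of_lt h]
    exact div_pos (by linarith) (log_inv_sub_one_pos hp h)
  · rw [h, lsFun_half]; norm_num
  · rw [lsFun, if_pos h]; norm_num

theorem hasSum_log_inv_sub_one {p : ℝ} (hp : 0 < p) (hp2 : p < 1 / 2) :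
    HasSum (fun k : ℕ => 2 * (1 / (2 * (k : ℝ) + 1)) * (1 - 2 * p) ^ (2 * k + 1))
      (Real.log (p⁻¹ - 1)) := by
  have := Real.hasSum_log_sub_log_of_abs_lt_one (x := 1 - 2 * p)
    (by rw [abs_lt]; constructor <;> linarith)
  rwa [← Real.log_div (by linarith) (by linarith),
    show (1 + (1 - 2 * p)) / (1 - (1 - 2 * p)) = p⁻¹ - 1 by field_simp; ring] at this

-- With `x = 1 - 2p`, `log (p⁻¹ - 1) / x` is a power series in `x²` with nonnegative coefficients,
-- so its reciprocal grows with `p`. The series are compared termwise after cross-multiplication.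
open WeightedComplex in
theorem lsFun_mono {p q : ℝ} (hp : 0 < p) (hpq : p ≤ q) (hq : q ≤ 1 / 2) : lsFun p ≤ lsFun q := by
  rcases hq.lt_or_eq with h | h
  · have hp2 : p < 1 / 2 := hpq.trans_lt h
    rw [lsFun_of_lt h, lsFun_of_lt hp2, div_le_div_iff₀ (log_inv_sub_one_pos hp hp2)
      (log_inv_sub_one_pos (hp.trans_le hpq) h)]
    refine hasSum_le (fun k => ?_)
      ((hasSum_log_inv_sub_one (hp.trans_le hpq) h).mul_left (1 - 2 * p))
      ((hasSum_log_inv_sub_one hp hp2).mul_left (1 - 2 * q))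
    have h1 : 0 < 1 - 2 * q := by linarith
    have h2 : (1 - 2 * q) ^ (2 * k) ≤ (1 - 2 * p) ^ (2 * k) :=
      pow_le_pow_left₀ h1.le (by linarith) _
    have h3 : 0 ≤ 2 * (1 / (2 * (k : ℝ) + 1)) * ((1 - 2 * p) * (1 - 2 * q)) := by
      have : 0 < 1 - 2 * p := by linarith
      positivity
    have := mul_le_mul_of_nonneg_left h2 h3
    calc _ = 2 * (1 / (2 * (k : ℝ) + 1)) * ((1 - 2 * p) * (1 - 2 * q)) * (1 - 2 * q) ^ (2 * k) := by
          ring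
      _ ≤ _ := this
      _ = _ := by ring
  · rw [h, lsFun_half]
    rcases (hpq.trans hq).lt_or_eq with hp2 | hp2
    · rw [lsFun_of_lt hp2, div_le_iff₀ (log_inv_sub_one_pos hp hp2)]
      -- The leading term of the series already gives `log (p⁻¹ - 1) ≥ 2 (1 - 2p)`.
      have := le_hasSum (hasSum_log_inv_sub_one hp hp2) 0 (fun k _ => by
        have : 0 < 1 - 2 * p := by linarith
        positivity)
      norm_num at this
      linarith
    · rw [hp2, lsFun_half]

open WeightedComplex in
theorem lsFun_mul_le_of_twoPointDefect {q t : ℝ} (hq : 0 < q) (hq2 : q ≤ 1 / 2) (ht : 0 < t) :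
    lsFun q * (q * t ^ 2 * (2 * Real.log t) -
      (q * t ^ 2 + (1 - q)) * Real.log (q * t ^ 2 + (1 - q))) ≤ q * (1 - q) * (t - 1) ^ 2 := by
  rcases hq2.lt_or_eq with h | h
  · have h0 := twoPointDefect_nonneg hq h ht
    have hl := lsFun_pos hq
    rw [lsFun_of_lt h] at hl ⊢
    have hLpos := log_inv_sub_one_pos hq h
    have hd : 0 < 1 - 2 * q := by linarith
    have h1 := mul_nonneg hl.le h0
    have h2 : (1 - 2 * q) / Real.log (q⁻¹ - 1) * (Real.log (q⁻¹ - 1) / (1 - 2 * q)) = 1 := by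
      rw [div_mul_div_comm, mul_comm, div_self (by positivity)]
    rw [twoPointDefect] at h1
    linear_combination h1 + q * (1 - q) * (t - 1) ^ 2 * h2
  · have h0 := twoPointDefect_half_nonneg ht
    rw [h, lsFun_half]
    rw [twoPointDefect] at h0
    linear_combination h0 / 2

-- Both sides are homogeneous of degree two in `(a, b)`, so this is the one-variable inequality at
-- `t = a / b` scaled by `b²`.
open WeightedComplex in
theorem two_point_logSobolev {q a b : ℝ} (hq : 0 < q) (hq2 : q ≤ 1 / 2) (ha : 0 < a) (hb : 0 < b) :
    lsFun q * (q * (a ^ 2 * Real.log (a ^ 2)) + (1 - q) * (b ^ 2 * Real.log (b ^ 2)) -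
      (q * a ^ 2 + (1 - q) * b ^ 2) * Real.log (q * a ^ 2 + (1 - q) * b ^ 2)) ≤
    q * a ^ 2 + (1 - q) * b ^ 2 - (q * a + (1 - q) * b) ^ 2 := by
  have ht : 0 < a / b := div_pos ha hb
  have h := mul_le_mul_of_nonneg_left (lsFun_mul_le_of_twoPointDefect hq hq2 ht) (sq_nonneg b)
  have hm : 0 < q * (a / b) ^ 2 + (1 - q) := by nlinarith [mul_pos hq (pow_pos ht 2)]
  have e : q * a ^ 2 + (1 - q) * b ^ 2 = b ^ 2 * (q * (a / b) ^ 2 + (1 - q)) := by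
    field_simp
  have hl : Real.log (q * a ^ 2 + (1 - q) * b ^ 2) =
      2 * Real.log b + Real.log (q * (a / b) ^ 2 + (1 - q)) := by
    rw [e, Real.log_mul (by positivity) hm.ne', Real.log_pow]; norm_num
  have ea : a ^ 2 = b ^ 2 * (a / b) ^ 2 := by field_simp
  have ea' : a = b * (a / b) := by field_simp
  have hla : Real.log (a ^ 2) = 2 * Real.log b + 2 * Real.log (a / b) := by
    rw [Real.log_pow, Real.log_div ha.ne' hb.ne']; push_cast; ring
  have hlb : Real.log (b ^ 2) = 2 * Real.log b := by rw [Real.log_pow]; norm_num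
  rw [hl, hla, hlb]
  generalize Real.log (q * (a / b) ^ 2 + (1 - q)) = L at *
  generalize Real.log (a / b) = L' at *
  generalize Real.log b = L'' at *
  generalize lsFun q = c at *
  generalize a / b = t at *
  subst ea'
  linear_combination h

-- Exchange the atoms so that the one of mass `q` is the lighter, then lower the constant from
-- `lsFun q` to `lsFun p` by monotonicity.
open WeightedComplex in
theorem two_point_logSobolev_of_le {p q a b : ℝ} (hp : 0 < p) (hpq : p ≤ q) (hpq' : p ≤ 1 - q)
    (ha : 0 < a) (hb : 0 < b) :
    lsFun p * (q * (a ^ 2 * Real.log (a ^ 2)) + (1 - q) * (b ^ 2 * Real.log (b ^ 2)) -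
      (q * a ^ 2 + (1 - q) * b ^ 2) * Real.log (q * a ^ 2 + (1 - q) * b ^ 2)) ≤
    q * a ^ 2 + (1 - q) * b ^ 2 - (q * a + (1 - q) * b) ^ 2 := by
  have key : ∀ {q a b : ℝ}, p ≤ q → q ≤ 1 / 2 → 0 < a → 0 < b →
      lsFun p * (q * (a ^ 2 * Real.log (a ^ 2)) + (1 - q) * (b ^ 2 * Real.log (b ^ 2)) -
        (q * a ^ 2 + (1 - q) * b ^ 2) * Real.log (q * a ^ 2 + (1 - q) * b ^ 2)) ≤
      q * a ^ 2 + (1 - q) * b ^ 2 - (q * a + (1 - q) * b) ^ 2 := by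
    intro q a b hpq hq2 ha hb
    have h := two_point_logSobolev (hp.trans_le hpq) hq2 ha hb
    have hv : 0 ≤ q * a ^ 2 + (1 - q) * b ^ 2 - (q * a + (1 - q) * b) ^ 2 := by
      have : 0 ≤ q * (1 - q) * (a - b) ^ 2 :=
        mul_nonneg (mul_nonneg (by linarith) (by linarith)) (sq_nonneg _)
      linear_combination this
    generalize (q * (a ^ 2 * Real.log (a ^ 2)) + (1 - q) * (b ^ 2 * Real.log (b ^ 2)) -
      (q * a ^ 2 + (1 - q) * b ^ 2) * Real.log (q * a ^ 2 + (1 - q) * b ^ 2)) = E at *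
    rcases le_total 0 E with hE | hE
    · exact (mul_le_mul_of_nonneg_right (lsFun_mono hp hpq hq2) hE).trans h
    · exact (mul_nonpos_of_nonneg_of_nonpos (lsFun_pos hp).le hE).trans hv
  rcases le_total q (1 / 2) with h | h
  · exact key hpq h ha hb
  · have := key hpq' (by linarith) hb ha
    rw [show 1 - (1 - q) = q by ring, add_comm ((1 - q) * b ^ 2),
      add_comm ((1 - q) * b), add_comm ((1 - q) * (b ^ 2 * _))] at this
    exact this

/-! ### The log-Sobolev inequality for the complete graph -/

namespace FinProb

variable {Ω : Type*} [Fintype Ω]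

theorem var_nonneg {μ : Ω → ℝ} (hμ0 : ∀ x, 0 ≤ μ x) (hμ : ∑ x, μ x = 1) (f : Ω → ℝ) :
    0 ≤ var μ f := by
  have h : ∑ x, μ x * (f x - expect μ f) ^ 2 = var μ f := by
    have e : ∀ x, μ x * (f x - expect μ f) ^ 2 =
        μ x * f x ^ 2 - 2 * expect μ f * (μ x * f x) + expect μ f ^ 2 * μ x := fun x => by ring
    simp only [e, sum_add_distrib, sum_sub_distrib, ← mul_sum, hμ]
    rw [var]
    simp only [expect]
    ring
  rw [← h]
  exact sum_nonneg fun x _ => mul_nonneg (hμ0 x) (sq_nonneg _)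

theorem ent_nonneg {μ f : Ω → ℝ} (hμ0 : ∀ x, 0 ≤ μ x) (hμ : ∑ x, μ x = 1) (hf : ∀ x, 0 ≤ f x) :
    0 ≤ ent μ f := by
  have := Real.convexOn_mul_log.map_sum_le (t := univ) (w := μ) (p := f) (fun x _ => hμ0 x) hμ
    (fun x _ => hf x)
  simp only [smul_eq_mul] at this
  exact sub_nonneg.mpr this

theorem expect_const_mul (μ f : Ω → ℝ) (c : ℝ) : expect μ (fun x => c * f x) = c * expect μ f := by
  simp only [expect, mul_sum]
  exact sum_congr rfl fun x _ => by ring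

theorem ent_const_mul (μ f : Ω → ℝ) (c : ℝ) : ent μ (fun x => c * f x) = c * ent μ f := by
  rcases eq_or_ne c 0 with rfl | hc
  · simp [ent, expect]
  have h1 : ∀ y : ℝ, c * y * Real.log (c * y) = c * Real.log c * y + c * (y * Real.log y) := by
    intro y
    rcases eq_or_ne y 0 with rfl | hy
    · simp
    · rw [Real.log_mul hc hy]; ring
  rw [ent, ent, expect_const_mul, h1]
  have : expect μ (fun x => c * f x * Real.log (c * f x)) =
      c * Real.log c * expect μ f + c * expect μ (fun x => f x * Real.log (f x)) := by
    rw [← expect_const_mul, ← expect_const_mul]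
    simp only [expect, h1, mul_add, sum_add_distrib]
  rw [this]
  ring

/-- The point `t = 0` matters: a minimizer is not yet known to be positive when it is perturbed.
There the difference quotient is `t log t → 0`. -/
theorem hasDerivAt_mul_mul_log (t : ℝ) :
    HasDerivAt (fun t : ℝ => t * (t * Real.log t)) (2 * (t * Real.log t) + t) t := by
  rcases eq_or_ne t 0 with rfl | ht
  · rw [hasDerivAt_iff_tendsto_slope]
    have : Filter.Tendsto (fun t : ℝ => t * Real.log t) (nhdsWithin 0 {0}ᶜ) (nhds 0) := by
      simpa using Real.continuous_mul_log.continuousAt.tendsto.mono_left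
        (nhdsWithin_le_nhds (a := (0 : ℝ)) (s := {0}ᶜ))
    simp only [zero_mul, mul_zero, add_zero]
    refine this.congr' ?_
    filter_upwards [self_mem_nhdsWithin] with x hx
    have : x ≠ 0 := hx
    simp [slope_def_field, this]
  · have := (hasDerivAt_id' t).mul (Real.hasDerivAt_mul_log ht)
    exact this.congr_deriv (by ring)

/-- The defect of the log-Sobolev inequality with constant `c` for the complete graph. -/
def lsDefect (c : ℝ) (μ f : Ω → ℝ) : ℝ := var μ f - c * ent μ (fun x => f x ^ 2)

theorem lsDefect_const_mul (c : ℝ) (μ f : Ω → ℝ) (r : ℝ) :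
    lsDefect c μ (fun x => r * f x) = r ^ 2 * lsDefect c μ f := by
  simp only [lsDefect, var, mul_pow, ent_const_mul, expect_const_mul]
  ring

theorem continuous_expect (μ : Ω → ℝ) {g : ℝ → ℝ} (hg : Continuous g) :
    Continuous fun f : Ω → ℝ => expect μ (fun x => g (f x)) :=
  continuous_finsetSum _ fun x _ => continuous_const.mul (hg.comp (continuous_apply x))

theorem continuous_lsDefect (c : ℝ) (μ : Ω → ℝ) : Continuous (lsDefect c μ) := by
  have h1 : Continuous fun y : ℝ => y ^ 2 := by fun_prop
  have h2 := continuous_expect μ h1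
  have h3 := continuous_expect μ (continuous_id (X := ℝ))
  have h4 := continuous_expect μ (Real.continuous_mul_log.comp h1)
  have h5 := Real.continuous_mul_log.comp h2
  exact (h2.sub (h3.pow 2)).sub (continuous_const.mul (h4.sub h5))

theorem expect_update [DecidableEq Ω] (μ f : Ω → ℝ) (x : Ω) (t : ℝ) (g : ℝ → ℝ) :
    expect μ (fun y => g (Function.update f x t y)) =
      μ x * g t + ∑ y ∈ univ.erase x, μ y * g (f y) := by
  rw [expect, ← add_sum_erase _ _ (mem_univ x), Function.update_self]
  congr 1
  exact sum_congr rfl fun y hy => by rw [Function.update_of_ne (ne_of_mem_erase hy)]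

/-- The Euler-Lagrange equation, as a one-variable derivative: `m` is a lower bound of the defect on
the unit sphere. -/
theorem hasDerivAt_lsDefect_update [DecidableEq Ω] (c m : ℝ) (μ f : Ω → ℝ) (x : Ω)
    (hf : expect μ (fun y => f y ^ 2) = 1) :
    HasDerivAt (fun t => lsDefect c μ (Function.update f x t) -
        m * expect μ (fun y => Function.update f x t y ^ 2))
      (2 * μ x * ((1 - m) * f x - expect μ f - 2 * c * (f x * Real.log (f x)))) (f x) := by
  set A := ∑ y ∈ univ.erase x, μ y * f y ^ 2
  set B := ∑ y ∈ univ.erase x, μ y * f y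
  set D := ∑ y ∈ univ.erase x, μ y * (f y ^ 2 * Real.log (f y ^ 2))
  have hA : μ x * f x ^ 2 + A = 1 := by
    rw [← hf, expect, ← add_sum_erase _ _ (mem_univ x)]
  have hB : μ x * f x + B = expect μ f := by
    rw [expect, ← add_sum_erase _ _ (mem_univ x)]
  have e : (fun t => lsDefect c μ (Function.update f x t) -
        m * expect μ (fun y => Function.update f x t y ^ 2)) =
      fun t => (1 - m) * (μ x * t ^ 2 + A) - (μ x * t + B) ^ 2 -
        c * (2 * μ x * (t * (t * Real.log t)) + D -
          (μ x * t ^ 2 + A) * Real.log (μ x * t ^ 2 + A)) := by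
    funext t
    have h1 := expect_update μ f x t (fun y => y ^ 2)
    have h2 := expect_update μ f x t (fun y => y)
    have h3 := expect_update μ f x t (fun y => y ^ 2 * Real.log (y ^ 2))
    simp only [lsDefect, var, ent]
    rw [h1, h2, h3, show Real.log (t ^ 2) = 2 * Real.log t by rw [Real.log_pow]; norm_num]
    ring
  rw [e]
  have d1 : HasDerivAt (fun t : ℝ => μ x * t ^ 2 + A) (μ x * (2 * f x)) (f x) := by
    simpa using ((hasDerivAt_pow 2 (f x)).const_mul (μ x)).add_const A
  have d2 : HasDerivAt (fun t : ℝ => (μ x * t + B) ^ 2) (2 * (μ x * f x + B) * μ x) (f x) := by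
    simpa using (((hasDerivAt_id' (f x)).const_mul (μ x)).add_const B).fun_pow 2
  have d3 := ((hasDerivAt_mul_mul_log (f x)).const_mul (2 * μ x)).add_const D
  -- By the normalization the argument of this logarithm is `1` at `f x`, which removes the term
  -- `log E f²` from the derivative.
  have d4 := d1.mul (d1.log (by rw [hA]; exact one_ne_zero))
  refine (((d1.const_mul (1 - m)).sub d2).sub ((d3.sub d4).const_mul c)).congr_deriv ?_
  rw [hA, hB, Real.log_one]
  ring

/-- Three roots would give `t log t` equal secant slopes `α / c` on adjacent intervals, against
strict convexity. -/
theorem not_three_roots_mul_log {c α e x y z : ℝ} (hc : 0 < c) (hx : 0 < x) (hxy : x < y)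
    (hyz : y < z) (h1 : α * x - e - c * (x * Real.log x) = 0)
    (h2 : α * y - e - c * (y * Real.log y) = 0) (h3 : α * z - e - c * (z * Real.log z) = 0) :
    False := by
  have := Real.strictConvexOn_mul_log.slope_strict_mono_adjacent (x := x) (y := y) (z := z)
    hx.le (by simp; linarith) hxy hyz
  have e1 : (y * Real.log y - x * Real.log x) / (y - x) = α / c := by
    rw [div_eq_div_iff (by linarith) hc.ne']; linear_combination h1 - h2
  have e2 : (z * Real.log z - y * Real.log y) / (z - y) = α / c := by
    rw [div_eq_div_iff (by linarith) hc.ne']; linear_combination h2 - h3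
  rw [e1, e2] at this
  exact lt_irrefl _ this

theorem eq_or_eq_of_roots_mul_log {c α e x y z : ℝ} (hc : 0 < c) (hx : 0 < x) (hy : 0 < y)
    (hz : 0 < z) (hxy : x ≠ y) (h1 : α * x - e - c * (x * Real.log x) = 0)
    (h2 : α * y - e - c * (y * Real.log y) = 0) (h3 : α * z - e - c * (z * Real.log z) = 0) :
    z = x ∨ z = y := by
  by_contra! h
  rcases hxy.lt_or_gt with a | a <;> rcases h.1.lt_or_gt with b | b <;>
    rcases h.2.lt_or_gt with d | d
  · exact not_three_roots_mul_log hc hz b a h3 h1 h2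
  · linarith
  · exact not_three_roots_mul_log hc hx b d h1 h3 h2
  · exact not_three_roots_mul_log hc hx a d h1 h2 h3
  · exact not_three_roots_mul_log hc hz d a h3 h2 h1
  · exact not_three_roots_mul_log hc hy d b h2 h3 h1
  · linarith
  · exact not_three_roots_mul_log hc hy a b h2 h1 h3

theorem expect_two_values (μ f : Ω → ℝ) (hμ : ∑ x, μ x = 1) {a b : ℝ} (hf : ∀ x, f x = a ∨ f x = b)
    (g : ℝ → ℝ) : expect μ (fun x => g (f x)) =
      (∑ x with f x = a, μ x) * g a + (1 - ∑ x with f x = a, μ x) * g b := by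
  rw [← hμ, ← sum_filter_add_sum_filter_not univ (fun x => f x = a) μ, add_sub_cancel_left, expect,
    ← sum_filter_add_sum_filter_not univ (fun x => f x = a), sum_mul, sum_mul]
  congr 1
  · exact sum_congr rfl fun x hx => by rw [(mem_filter.mp hx).2]
  · exact sum_congr rfl fun x hx => by rw [(hf x).resolve_left (mem_filter.mp hx).2]

/-- Only the law of `f` matters, and it has two atoms; each contains a point of the space, hence has
mass at least `p`. -/
theorem lsDefect_nonneg_of_two_values {μ f : Ω → ℝ} {p : ℝ} (hμ : ∑ x, μ x = 1) (hp0 : 0 < p)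
    (hp : ∀ x, p ≤ μ x) {x y : Ω} (hxy : f x ≠ f y) (hx : 0 < f x) (hy : 0 < f y)
    (hf : ∀ z, f z = f x ∨ f z = f y) : 0 ≤ lsDefect (WeightedComplex.lsFun p) μ f := by
  have h := expect_two_values μ f hμ hf
  have hpos : ∀ z, 0 ≤ μ z := fun z => hp0.le.trans (hp z)
  have h1 : p ≤ ∑ z with f z = f x, μ z :=
    (hp x).trans (single_le_sum (f := μ) (fun z _ => hpos z) (by simp))
  have h2 : p ≤ 1 - ∑ z with f z = f x, μ z := by
    rw [← hμ, ← sum_filter_add_sum_filter_not univ (fun z => f z = f x) μ, add_sub_cancel_left]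
    exact (hp y).trans (single_le_sum (f := μ) (fun z _ => hpos z) (by simp [hxy.symm]))
  have := two_point_logSobolev_of_le hp0 h1 h2 hx hy
  have e1 := h (fun y => y ^ 2)
  have e2 := h (fun y => y)
  have e3 := h (fun y => y ^ 2 * Real.log (y ^ 2))
  rw [lsDefect, var, ent, e1, e2, e3]
  linarith

/-- The log-Sobolev inequality for the complete graph (Diaconis and Saloff-Coste). -/
theorem lsDefect_nonneg {μ f : Ω → ℝ} {p : ℝ} (hμ : ∑ x, μ x = 1) (hp0 : 0 < p)
    (hp : ∀ x, p ≤ μ x) (hf : ∀ x, 0 ≤ f x) : 0 ≤ lsDefect (WeightedComplex.lsFun p) μ f := by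
  classical
  set c := WeightedComplex.lsFun p
  have hc : 0 < c := lsFun_pos hp0
  have hpos : ∀ x, 0 < μ x := fun x => hp0.trans_le (hp x)
  set S : Set (Ω → ℝ) := {f | (∀ x, 0 ≤ f x) ∧ expect μ (fun x => f x ^ 2) = 1}
  have hclosed : IsClosed S := by
    refine IsClosed.inter ?_ ?_
    · exact isClosed_Ici (a := (0 : Ω → ℝ))
    · exact isClosed_eq (continuous_expect μ (g := fun y => y ^ 2) (by fun_prop)) continuous_const
  have hbdd : S ⊆ Set.Icc (fun _ => 0) (fun _ => 1 + 1 / p) := by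
    intro g hg
    refine ⟨hg.1, fun x => ?_⟩
    have h1 : μ x * g x ^ 2 ≤ 1 := by
      rw [← hg.2]
      exact single_le_sum (f := fun x => μ x * g x ^ 2)
        (fun y _ => mul_nonneg (hpos y).le (sq_nonneg _)) (mem_univ x)
    have h2 : g x ^ 2 ≤ 1 / p := by
      rw [le_div_iff₀ hp0]
      nlinarith [hp x, sq_nonneg (g x)]
    nlinarith [sq_nonneg (g x - 1), hg.1 x, h2]
  have hcomp : IsCompact S := isCompact_Icc.of_isClosed_subset hclosed hbdd
  have hone : (fun _ => 1) ∈ S := ⟨fun _ => zero_le_one, by simp [expect, hμ]⟩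
  obtain ⟨f₀, ⟨hf₀, hn⟩, hmin⟩ := hcomp.exists_isMinOn ⟨_, hone⟩ (continuous_lsDefect c μ).continuousOn
  have hnn : ∀ g : Ω → ℝ, 0 ≤ expect μ (fun x => g x ^ 2) := fun g =>
    sum_nonneg fun y _ => mul_nonneg (hpos y).le (sq_nonneg _)
  -- By homogeneity the minimum on the sphere becomes an unconstrained one over nonnegative `g`,
  -- with the minimal value in the role of the Lagrange multiplier. Single coordinates can then be
  -- varied freely.
  have hhom : ∀ g : Ω → ℝ, (∀ x, 0 ≤ g x) →
      0 ≤ lsDefect c μ g - lsDefect c μ f₀ * expect μ (fun x => g x ^ 2) := by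
    intro g hg
    rcases (hnn g).eq_or_lt with h | h
    · have h0 : ∀ x, g x = 0 := fun x => by
        have := (sum_eq_zero_iff_of_nonneg (fun y _ => mul_nonneg (hpos y).le (sq_nonneg _))).mp
          h.symm x (mem_univ x)
        simpa [(hpos x).ne'] using this
      have : g = fun _ => 0 := funext h0
      subst this
      simp [lsDefect, var, ent, expect]
    · set s := expect μ (fun x => g x ^ 2) with hs
      have hm : (fun x => (√s)⁻¹ * g x) ∈ S := by
        refine ⟨fun x => mul_nonneg (by positivity) (hg x), ?_⟩
        simp only [mul_pow, expect_const_mul, inv_pow, Real.sq_sqrt h.le, ← hs]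
        exact inv_mul_cancel₀ h.ne'
      have := hmin hm
      simp only [Set.mem_ofPred_eq, lsDefect_const_mul, inv_pow, Real.sq_sqrt h.le] at this
      rw [inv_mul_eq_div, le_div_iff₀ h] at this
      linarith
  set m := lsDefect c μ f₀ with hm
  suffices hm0 : 0 ≤ m by
    have := hhom f hf
    nlinarith [mul_nonneg hm0 (hnn f)]
  have hder := fun x => hasDerivAt_lsDefect_update c m μ f₀ x hn
  have hzero : ∀ x, lsDefect c μ (Function.update f₀ x (f₀ x)) -
        m * expect μ (fun y => Function.update f₀ x (f₀ x) y ^ 2) = 0 := fun x => by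
    rw [Function.update_eq_self, hn]; ring
  have hupd : ∀ x t, 0 ≤ t → 0 ≤ lsDefect c μ (Function.update f₀ x t) -
        m * expect μ (fun y => Function.update f₀ x t y ^ 2) := fun x t ht => by
    refine hhom _ fun y => ?_
    rcases eq_or_ne y x with rfl | h
    · simpa using ht
    · simpa [h] using hf₀ y
  have hE : 0 < expect μ f₀ := by
    rw [expect]
    refine lt_of_le_of_ne (sum_nonneg fun y _ => mul_nonneg (hpos y).le (hf₀ y)) fun h => ?_
    have h0 := (sum_eq_zero_iff_of_nonneg (fun y _ => mul_nonneg (hpos y).le (hf₀ y))).mp h.symm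
    have h1 : ∀ x, f₀ x = 0 := fun x => by simpa [(hpos x).ne'] using h0 x (mem_univ x)
    simp [expect, h1] at hn
  have hfpos : ∀ x, 0 < f₀ x := by
    intro x
    refine lt_of_le_of_ne (hf₀ x) fun h => ?_
    -- At a zero of `f₀` the derivative is `-2 μ(x) E f₀ < 0`, while minimality makes every right
    -- difference quotient nonnegative.
    have hd := hder x
    rw [← h] at hd
    have ht := (hasDerivAt_iff_tendsto_slope.mp hd).mono_left
      (nhdsWithin_mono 0 (fun y (hy : y ∈ Set.Ioi (0 : ℝ)) => (ne_of_gt hy : y ≠ 0)))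
    have hge := ge_of_tendsto (b := 0) ht (by
      filter_upwards [self_mem_nhdsWithin] with y hy
      have hy : 0 < y := hy
      have hz := hzero x
      rw [← h] at hz
      rw [slope_def_field, hz]
      exact div_nonneg (by simpa using hupd x y hy.le) (by linarith))
    have := mul_pos (hpos x) hE
    simp only [mul_zero, zero_mul] at hge
    nlinarith
  have hEL : ∀ x, (1 - m) * f₀ x - expect μ f₀ - 2 * c * (f₀ x * Real.log (f₀ x)) = 0 := by
    intro x
    have hloc : IsLocalMin (fun t => lsDefect c μ (Function.update f₀ x t) -
        m * expect μ (fun y => Function.update f₀ x t y ^ 2)) (f₀ x) := by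
      filter_upwards [lt_mem_nhds (hfpos x)] with t ht
      rw [hzero x]
      exact hupd x t ht.le
    have := hloc.hasDerivAt_eq_zero (hder x)
    have h2 := (hpos x).ne'
    simpa [h2] using this
  -- A constant minimizer has defect `0`; otherwise the Euler-Lagrange equation allows exactly two
  -- values.
  by_cases hconst : ∀ x y, f₀ x = f₀ y
  · rcases isEmpty_or_nonempty Ω with hΩ | ⟨⟨x⟩⟩
    · simp at hμ
    · have : f₀ = fun _ => f₀ x := funext fun y => hconst y x
      rw [hm, this]
      simp [lsDefect, var, ent, expect, ← sum_mul, hμ]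
  · push Not at hconst
    obtain ⟨x, y, hxy⟩ := hconst
    exact lsDefect_nonneg_of_two_values hμ hp0 hp hxy (hfpos x) (hfpos y) fun z =>
      eq_or_eq_of_roots_mul_log (by positivity) (hfpos x) (hfpos y) (hfpos z) hxy (hEL x) (hEL y)
        (hEL z)

/-! ### Entropy and variance under a Markov kernel -/

variable {Ω' : Type*} [Fintype Ω']

theorem expect_of_vecMul {μ : Ω → ℝ} {ν : Ω' → ℝ} {P : Matrix Ω Ω' ℝ}
    (hP : ∀ y, ∑ x, μ x * P x y = ν y) (f : Ω' → ℝ) : expect ν f = expect μ (P.mulVec f) := by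
  simp only [expect, Matrix.mulVec, dotProduct, ← hP, sum_mul, mul_sum]
  rw [sum_comm]
  exact sum_congr rfl fun x _ => sum_congr rfl fun y _ => by ring

/-- The chain rule for entropy. -/
theorem ent_chain {μ : Ω → ℝ} {ν : Ω' → ℝ} {P : Matrix Ω Ω' ℝ}
    (hP : ∀ y, ∑ x, μ x * P x y = ν y) (f : Ω' → ℝ) :
    ent ν f = expect μ (fun x => ent (P x) f) + ent μ (P.mulVec f) := by
  rw [ent, ent, expect_of_vecMul hP, expect_of_vecMul hP]
  have : expect μ (fun x => ent (P x) f) = expect μ (P.mulVec fun y => f y * Real.log (f y)) -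
      expect μ (fun x => P.mulVec f x * Real.log (P.mulVec f x)) := by
    simp only [expect, ← sum_sub_distrib, ← mul_sub]
    rfl
  rw [this]
  ring

/-- The chain rule and Jensen bound all ratios by `1`, so the real supremum is a genuine bound and
not a default value. If `Ent_ν f = 0`, the same comparison gives the claim. -/
theorem ent_mulVec_le_entRatio_mul {μ : Ω → ℝ} {ν : Ω' → ℝ} {P : Matrix Ω Ω' ℝ}
    (hμ0 : ∀ x, 0 ≤ μ x) (hμ : ∑ x, μ x = 1)
    (hP0 : ∀ x y, 0 ≤ P x y) (hP1 : ∀ x, ∑ y, P x y = 1)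
    (hP : ∀ y, ∑ x, μ x * P x y = ν y) {f : Ω' → ℝ} (hf : ∀ y, 0 ≤ f y) :
    ent μ (P.mulVec f) ≤ entRatio μ ν P * ent ν f ∧ entRatio μ ν P ≤ 1 := by
  have hle : ∀ g : Ω' → ℝ, (∀ y, 0 ≤ g y) → 0 ≤ ent μ (P.mulVec g) ∧
      ent μ (P.mulVec g) ≤ ent ν g := by
    intro g hg
    refine ⟨ent_nonneg hμ0 hμ fun x => sum_nonneg fun y _ => mul_nonneg (hP0 x y) (hg y), ?_⟩
    rw [ent_chain hP g]
    have : 0 ≤ expect μ (fun x => ent (P x) g) :=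
      sum_nonneg fun x _ => mul_nonneg (hμ0 x) (ent_nonneg (hP0 x) (hP1 x) hg)
    linarith
  have hub : ∀ r ∈ {r : ℝ | ∃ f : Ω' → ℝ, (∀ x, 0 ≤ f x) ∧ ent ν f ≠ 0 ∧
      r = ent μ (P.mulVec f) / ent ν f}, r ≤ 1 := by
    rintro r ⟨g, hg, -, rfl⟩
    exact div_le_one_of_le₀ (hle g hg).2 ((hle g hg).1.trans (hle g hg).2)
  refine ⟨?_, Real.sSup_le hub zero_le_one⟩
  rcases eq_or_ne (ent ν f) 0 with h | h
  · rw [h, mul_zero, ← h]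
    exact (hle f hf).2
  · have hpos : 0 < ent ν f := lt_of_le_of_ne ((hle f hf).1.trans (hle f hf).2) h.symm
    rw [← div_le_iff₀ hpos]
    exact le_csSup ⟨1, hub⟩ ⟨f, hf, h, rfl⟩

/-! ### Log-Sobolev constants, Dirichlet forms and spectral gaps -/

theorem le_logSobolev {μ : Ω → ℝ} (hμ0 : ∀ x, 0 ≤ μ x) (hμ : ∑ x, μ x = 1) {P : Matrix Ω Ω ℝ}
    {r : ℝ} (h : ∀ f : Ω → ℝ, (∀ x, 0 ≤ f x) →
      r * ent μ (fun x => f x ^ 2) ≤ dirichlet μ P f) : (r : EReal) ≤ logSobolev μ P := by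
  refine le_sInf ?_
  rintro _ ⟨f, hf, hne, rfl⟩
  rw [EReal.coe_le_coe_iff, le_div_iff₀]
  · exact h f hf
  · exact lt_of_le_of_ne (ent_nonneg hμ0 hμ fun x => sq_nonneg _) hne.symm

theorem dirichlet_eq (μ : Ω → ℝ) (P : Matrix Ω Ω ℝ) (f : Ω → ℝ) :
    dirichlet μ P f = ∑ x, μ x * f x ^ 2 - ∑ x, ∑ y, μ x * P x y * (f x * f y) := by
  simp only [dirichlet, expect, Matrix.mulVec, dotProduct, mul_sub, sum_sub_distrib, mul_sum]
  congr 1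
  · exact sum_congr rfl fun x _ => by ring
  · exact sum_congr rfl fun x _ => sum_congr rfl fun y _ => by ring

/-- The Dirichlet form of a reversible stochastic matrix is nonnegative. -/
theorem dirichlet_nonneg {μ : Ω → ℝ} {P : Matrix Ω Ω ℝ} (h0 : ∀ x y, 0 ≤ μ x * P x y)
    (hrev : ∀ x y, μ x * P x y = μ y * P y x) (hP : ∀ x, ∑ y, P x y = 1) (f : Ω → ℝ) :
    0 ≤ dirichlet μ P f := by
  have e1 : ∑ x, ∑ y, μ x * P x y * f x ^ 2 = ∑ x, μ x * f x ^ 2 :=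
    sum_congr rfl fun x _ => by
      rw [← mul_one (μ x * f x ^ 2), ← hP x, mul_sum]
      exact sum_congr rfl fun y _ => by ring
  have h : ∑ x, ∑ y, μ x * P x y * (f x - f y) ^ 2 = 2 * dirichlet μ P f := by
    calc _ = ∑ x, ∑ y, μ x * P x y * f x ^ 2 + ∑ x, ∑ y, μ y * P y x * f y ^ 2 -
          2 * ∑ x, ∑ y, μ x * P x y * (f x * f y) := by
          simp only [mul_sum, ← sum_add_distrib, ← sum_sub_distrib]
          exact sum_congr rfl fun x _ => sum_congr rfl fun y _ => by rw [← hrev x y]; ring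
      _ = _ := by
          rw [sum_comm (f := fun x y => μ y * P y x * f y ^ 2), e1, dirichlet_eq]
          ring
  have : 0 ≤ ∑ x, ∑ y, μ x * P x y * (f x - f y) ^ 2 :=
    sum_nonneg fun x _ => sum_nonneg fun y _ => mul_nonneg (h0 x y) (sq_nonneg _)
  linarith

theorem gap_nonneg {μ : Ω → ℝ} {P : Matrix Ω Ω ℝ} (hμ0 : ∀ x, 0 ≤ μ x) (hμ : ∑ x, μ x = 1)
    (hD : ∀ f, 0 ≤ dirichlet μ P f) : 0 ≤ gap μ P := by
  refine Real.sInf_nonneg ?_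
  rintro _ ⟨g, -, rfl⟩
  exact div_nonneg (hD g) (var_nonneg hμ0 hμ g)

/-- Nonnegativity of the Dirichlet form bounds the quotients below, so the real infimum is a true
lower bound; it also settles the case of zero variance. -/
theorem gap_mul_var_le {μ : Ω → ℝ} {P : Matrix Ω Ω ℝ} (hμ0 : ∀ x, 0 ≤ μ x) (hμ : ∑ x, μ x = 1)
    (hD : ∀ f, 0 ≤ dirichlet μ P f) (f : Ω → ℝ) : gap μ P * var μ f ≤ dirichlet μ P f := by
  rcases (var_nonneg hμ0 hμ f).eq_or_lt with h | h
  · rw [← h, mul_zero]; exact hD f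
  · rw [← le_div_iff₀ h]
    refine csInf_le ⟨0, ?_⟩ ⟨f, h.ne', rfl⟩
    rintro _ ⟨g, -, rfl⟩
    exact div_nonneg (hD g) (var_nonneg hμ0 hμ g)

end FinProb

/-! ### Faces, level distributions and the up and down walks -/

namespace WeightedComplex

open FinProb

variable {U : Type*} [DecidableEq U] {n : ℕ}

theorem Face.mem {X : WeightedComplex U n} {j : ℕ} (α : X.Face j) : α.1 ∈ X.faces := X.face_mem α

theorem Face.card_eq {X : WeightedComplex U n} {j : ℕ} (α : X.Face j) : α.1.card = j :=
  (mem_filter.mp α.2).2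

theorem card_le_rank (X : WeightedComplex U n) {α : Finset U} (hα : α ∈ X.faces) : α.card ≤ n := by
  obtain ⟨β, -, h, rfl⟩ := X.pure α hα
  exact card_le_card h

theorem Face.le_rank {X : WeightedComplex U n} {j : ℕ} (α : X.Face j) : j ≤ n :=
  α.card_eq ▸ X.card_le_rank α.mem

theorem prob_face_pos (X : WeightedComplex U n) {j : ℕ} (α : X.Face j) : 0 < X.prob α.1 :=
  X.prob_pos α.mem

theorem exists_top_face (X : WeightedComplex U n) : Nonempty (X.Face n) := by
  by_contra h
  have : X.faces.filter (fun β => β.card = n) = ∅ := by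
    by_contra h'
    obtain ⟨β, hβ⟩ := nonempty_iff_ne_empty.mpr h'
    exact h ⟨⟨β, hβ⟩⟩
  have h1 := X.weight_sum
  rw [this] at h1
  simp at h1

theorem face_nonempty (X : WeightedComplex U n) {j : ℕ} (hj : j ≤ n) : Nonempty (X.Face j) := by
  obtain ⟨ω⟩ := X.exists_top_face
  obtain ⟨α, hα, hc⟩ := exists_subset_card_eq (s := ω.1) (n := j) (by rw [ω.card_eq]; exact hj)
  exact ⟨⟨α, mem_filter.mpr ⟨X.down_closed _ ω.mem _ hα, hc⟩⟩⟩

theorem prob_eq_sum_weight (X : WeightedComplex U n) (α : Finset U) :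
    X.prob α = ∑ ω : X.Face n, if α ⊆ ω.1 then X.weight ω.1 else 0 := by
  rw [prob, ← filter_filter, sum_filter]
  exact (sum_coe_sort (X.faces.filter fun β => β.card = n)
    (fun ω => if α ⊆ ω then X.weight ω else 0)).symm

theorem prob_top (X : WeightedComplex U n) (ω : X.Face n) : X.prob ω.1 = X.weight ω.1 := by
  rw [prob_eq_sum_weight, sum_eq_single ω]
  · simp
  · intro τ _ hτ
    refine if_neg fun h => hτ (Subtype.ext (eq_of_subset_of_card_le h ?_).symm)
    rw [τ.card_eq, ω.card_eq]
  · simp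

theorem prob_eq_sum (X : WeightedComplex U n) (α : Finset U) :
    X.prob α = ∑ ω : X.Face n, if α ⊆ ω.1 then X.prob ω.1 else 0 := by
  simp only [prob_top, prob_eq_sum_weight X α]

theorem prob_empty (X : WeightedComplex U n) : X.prob ∅ = 1 := by
  rw [← X.weight_sum, prob]
  simp

theorem prob_nonneg (X : WeightedComplex U n) (α : Finset U) : 0 ≤ X.prob α := by
  rw [prob_eq_sum]
  refine sum_nonneg fun ω _ => ?_
  split_ifs
  exacts [(X.prob_face_pos ω).le, le_rfl]

theorem exists_top_of_prob_ne_zero (X : WeightedComplex U n) {α : Finset U} (h : X.prob α ≠ 0) :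
    ∃ ω : X.Face n, α ⊆ ω.1 := by
  by_contra! h'
  exact h (by rw [prob_eq_sum]; exact sum_eq_zero fun ω _ => if_neg (h' ω))

theorem card_face_between (X : WeightedComplex U n) {α ω : Finset U} (hω : ω ∈ X.faces)
    (h : α ⊆ ω) {k : ℕ} (hk : α.card ≤ k) :
    #{τ : X.Face k | α ⊆ τ.1 ∧ τ.1 ⊆ ω} = (ω.card - α.card).choose (k - α.card) := by
  rw [← card_sdiff_of_subset h, ← card_powersetCard]
  refine card_bij (fun τ _ => τ.1 \ α) ?_ ?_ ?_
  · intro τ hτ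
    simp only [mem_filter, mem_univ, true_and] at hτ
    rw [mem_powersetCard, card_sdiff_of_subset hτ.1, τ.card_eq]
    exact ⟨sdiff_subset_sdiff hτ.2 subset_rfl, rfl⟩
  · intro τ hτ σ hσ hτσ
    simp only [mem_filter, mem_univ, true_and] at hτ hσ
    apply Subtype.ext
    rw [← union_sdiff_of_subset hτ.1, hτσ, union_sdiff_of_subset hσ.1]
  · intro ρ hρ
    rw [mem_powersetCard] at hρ
    have hd : Disjoint ρ α := disjoint_of_subset_left hρ.1 sdiff_disjoint
    have hsub : ρ ∪ α ⊆ ω := union_subset (hρ.1.trans sdiff_subset) h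
    refine ⟨⟨ρ ∪ α, mem_filter.mpr ⟨X.down_closed _ hω _ hsub, ?_⟩⟩, ?_, ?_⟩
    · rw [card_union_of_disjoint hd, hρ.2]; omega
    · simp [hsub]
    · simp only [union_sdiff_right, sdiff_eq_self_of_disjoint hd]

theorem sum_face_between (X : WeightedComplex U n) {α ω : Finset U} (hω : ω ∈ X.faces)
    {k : ℕ} (hk : α.card ≤ k) :
    (∑ τ : X.Face k, if α ⊆ τ.1 then (if τ.1 ⊆ ω then (1 : ℝ) else 0) else 0) =
      if α ⊆ ω then ((ω.card - α.card).choose (k - α.card) : ℝ) else 0 := by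
  simp only [← ite_and]
  split_ifs with h
  · rw [← X.card_face_between hω h hk, ← natCast_card_filter]
  · exact sum_eq_zero fun τ _ => if_neg fun h' => h (h'.1.trans h'.2)

/-- Double counting: each top face above `α` contains `binom(n - |α|, k - |α|)` faces of size `k`
above `α`. -/
theorem sum_prob_above (X : WeightedComplex U n) {α : Finset U} {k : ℕ} (hk : α.card ≤ k) :
    (∑ τ : X.Face k, if α ⊆ τ.1 then X.prob τ.1 else 0) =
      ((n - α.card).choose (k - α.card) : ℝ) * X.prob α := by
  have h1 : ∀ τ : X.Face k, (if α ⊆ τ.1 then X.prob τ.1 else 0) = ∑ ω : X.Face n,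
      X.prob ω.1 * if α ⊆ τ.1 then (if τ.1 ⊆ ω.1 then (1 : ℝ) else 0) else 0 := by
    intro τ
    split_ifs
    · rw [prob_eq_sum]
      exact sum_congr rfl fun ω _ => by split_ifs <;> simp
    · simp
  simp only [h1]
  rw [sum_comm, X.prob_eq_sum α, mul_sum]
  refine sum_congr rfl fun ω _ => ?_
  rw [← mul_sum, X.sum_face_between ω.mem hk, ω.card_eq]
  split_ifs <;> ring

theorem up_nonneg (X : WeightedComplex U n) {ℓ k : ℕ} (α : X.Face ℓ) (τ : X.Face k) :
    0 ≤ X.up ℓ k α τ := by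
  rw [up]
  split_ifs
  · have := X.prob_nonneg τ.1
    have := X.prob_nonneg α.1
    positivity
  · exact le_rfl

theorem choose_sub_ne_zero {ℓ k n : ℕ} (h : k ≤ n) : ((n - ℓ).choose (k - ℓ) : ℝ) ≠ 0 :=
  Nat.cast_ne_zero.mpr (Nat.choose_pos (Nat.sub_le_sub_right h ℓ)).ne'

theorem sum_up (X : WeightedComplex U n) {ℓ k : ℕ} (hk : ℓ ≤ k) (hn : k ≤ n) (α : X.Face ℓ) :
    ∑ τ, X.up ℓ k α τ = 1 := by
  have h := X.sum_prob_above (α := α.1) (k := k) (by rw [α.card_eq]; exact hk)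
  have e : ∀ τ, X.up ℓ k α τ =
      (if α.1 ⊆ τ.1 then X.prob τ.1 else 0) / X.prob α.1 / ((n - ℓ).choose (k - ℓ) : ℝ) := by
    intro τ
    rw [up]
    split_ifs <;> simp
  simp only [e, ← sum_div]
  rw [h, α.card_eq]
  have := (X.prob_face_pos α).ne'
  have := choose_sub_ne_zero (ℓ := ℓ) hn
  field_simp

theorem up_mul_up (X : WeightedComplex U n) {ℓ k m : ℕ} (hk : ℓ ≤ k) (hm : k ≤ m) (hn : m ≤ n) :
    X.up ℓ k * X.up k m = X.up ℓ m := by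
  ext α ω
  have h := X.sum_face_between (α := α.1) ω.mem (k := k) (by rw [α.card_eq]; exact hk)
  have hc : (((n - ℓ).choose (m - ℓ) : ℕ) : ℝ) * ((m - ℓ).choose (k - ℓ) : ℕ) =
      ((n - ℓ).choose (k - ℓ) : ℕ) * ((n - k).choose (m - k) : ℕ) := by
    have := Nat.choose_mul (n := n - ℓ) (k := m - ℓ) (s := k - ℓ) (by omega)
    rw [show n - ℓ - (k - ℓ) = n - k by omega, show m - ℓ - (k - ℓ) = m - k by omega] at this
    exact_mod_cast this
  have hα := (X.prob_face_pos α).ne'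
  have c1 := choose_sub_ne_zero (ℓ := ℓ) hn
  have c2 := choose_sub_ne_zero (ℓ := ℓ) (hm.trans hn)
  have c3 := choose_sub_ne_zero (ℓ := k) hn
  have e : ∀ τ, X.up ℓ k α τ * X.up k m τ ω =
      X.prob ω.1 / X.prob α.1 / ((n - ℓ).choose (k - ℓ)) / ((n - k).choose (m - k)) *
        if α.1 ⊆ τ.1 then (if τ.1 ⊆ ω.1 then (1 : ℝ) else 0) else 0 := by
    intro τ
    have := (X.prob_face_pos τ).ne'
    rw [up, up]
    split_ifs <;> field_simp <;> simp
  rw [Matrix.mul_apply]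
  simp only [e, ← mul_sum]
  rw [h, up, α.card_eq, ω.card_eq]
  split_ifs
  · have c4 : (((m - ℓ).choose (k - ℓ) : ℕ) : ℝ) ≠ 0 := choose_sub_ne_zero hm
    rw [div_div, div_div, ← hc]
    field_simp
  · simp

theorem level_pos (X : WeightedComplex U n) {k : ℕ} (α : X.Face k) : 0 < X.level k α :=
  div_pos (X.prob_face_pos α) (Nat.cast_pos.mpr (Nat.choose_pos α.le_rank))

theorem sum_level (X : WeightedComplex U n) {k : ℕ} (hk : k ≤ n) : ∑ α, X.level k α = 1 := by
  have := X.sum_prob_above (α := ∅) (k := k) (by simp)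
  simp only [empty_subset, if_true, prob_empty, card_empty, Nat.sub_zero, mul_one] at this
  simp only [level, ← sum_div]
  rw [this, div_self (Nat.cast_ne_zero.mpr (Nat.choose_pos hk).ne')]

/-- Detailed balance: the up and down walks are adjoint. Stationarity of the levels and the
Dirichlet form of the down-up walk follow from it. -/
theorem level_mul_up (X : WeightedComplex U n) {ℓ k : ℕ} (hk : ℓ ≤ k) (hn : k ≤ n)
    (α : X.Face ℓ) (τ : X.Face k) :
    X.level ℓ α * X.up ℓ k α τ = X.level k τ * X.down k ℓ τ α := by
  rw [level, level, up, down]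
  split_ifs
  · have hα := (X.prob_face_pos α).ne'
    have hc : ((n.choose k : ℕ) : ℝ) * (k.choose ℓ : ℕ) =
        (n.choose ℓ : ℕ) * ((n - ℓ).choose (k - ℓ) : ℕ) := by
      exact_mod_cast Nat.choose_mul hk
    have c1 : ((n.choose ℓ : ℕ) : ℝ) ≠ 0 :=
      Nat.cast_ne_zero.mpr (Nat.choose_pos (hk.trans hn)).ne'
    have c2 : ((n.choose k : ℕ) : ℝ) ≠ 0 := Nat.cast_ne_zero.mpr (Nat.choose_pos hn).ne'
    have c3 : ((k.choose ℓ : ℕ) : ℝ) ≠ 0 := Nat.cast_ne_zero.mpr (Nat.choose_pos hk).ne'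
    have c4 := choose_sub_ne_zero (ℓ := ℓ) hn
    field_simp
    linear_combination X.prob τ.1 * hc
  · simp

theorem sum_down (X : WeightedComplex U n) {ℓ k : ℕ} (hk : ℓ ≤ k) (τ : X.Face k) :
    ∑ α, X.down k ℓ τ α = 1 := by
  have := X.sum_face_between (α := ∅) τ.mem (k := ℓ) (by simp)
  simp only [empty_subset, if_true, card_empty, Nat.sub_zero, τ.card_eq] at this
  have e : ∀ α, X.down k ℓ τ α = (if α.1 ⊆ τ.1 then (1 : ℝ) else 0) / (k.choose ℓ : ℝ) := by
    intro α
    rw [down]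
    split_ifs <;> simp
  simp only [e, ← sum_div]
  rw [this, div_self (Nat.cast_ne_zero.mpr (Nat.choose_pos hk).ne')]

theorem sum_level_mul_up (X : WeightedComplex U n) {ℓ k : ℕ} (hk : ℓ ≤ k) (hn : k ≤ n)
    (τ : X.Face k) : ∑ α, X.level ℓ α * X.up ℓ k α τ = X.level k τ := by
  simp only [X.level_mul_up hk hn, ← mul_sum, X.sum_down hk, mul_one]

/-! ### Links -/

/-- The map `σ ↦ α ∪ σ` from the faces of the link of `α` to the faces of `X`. -/
def join (X : WeightedComplex U n) {j k m : ℕ} (α : X.Face j) (h : j + k = m)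
    (σ : (X.linkAt α).Face k) : X.Face m :=
  ⟨α.1 ∪ σ.1, by
    have hσ := σ.mem
    simp only [link, mem_image, mem_filter] at hσ
    obtain ⟨β, ⟨hβ, hαβ⟩, hσ⟩ := hσ
    refine mem_filter.mpr ⟨?_, ?_⟩
    · rwa [← hσ, union_sdiff_of_subset hαβ]
    · have hc := σ.card_eq
      have hc' := α.card_eq
      rw [card_union_of_disjoint (by rw [← hσ]; exact disjoint_sdiff)]
      omega⟩

theorem link_disjoint (X : WeightedComplex U n) {j k : ℕ} (α : X.Face j)
    (σ : (X.linkAt α).Face k) : Disjoint σ.1 α.1 := by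
  have hσ := σ.mem
  simp only [link, mem_image, mem_filter] at hσ
  obtain ⟨β, -, hσ⟩ := hσ
  rw [← hσ]
  exact sdiff_disjoint

theorem subset_join (X : WeightedComplex U n) {j k m : ℕ} (α : X.Face j) (h : j + k = m)
    (σ : (X.linkAt α).Face k) : α.1 ⊆ (X.join α h σ).1 := subset_union_left

theorem union_subset_union_iff {α σ τ : Finset U} (h : Disjoint σ α) : α ∪ σ ⊆ α ∪ τ ↔ σ ⊆ τ := by
  refine ⟨fun h' x hx => ?_, fun h' => union_subset_union_right h'⟩
  have := h' (mem_union_right _ hx)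
  exact (mem_union.mp this).resolve_left (disjoint_left.mp h hx)

/-- Turns sums over the link into sums over the faces of `X` above `α`. Keeping the size `m` free
with a proof of `j + k = m` avoids casts between face types. -/
theorem sum_join (X : WeightedComplex U n) {j k m : ℕ} (α : X.Face j) (h : j + k = m)
    (F : X.Face m → ℝ) :
    ∑ σ, F (X.join α h σ) = ∑ τ, if α.1 ⊆ τ.1 then F τ else 0 := by
  rw [← sum_filter]
  refine sum_bij (fun σ _ => X.join α h σ) (fun σ _ => by simp [subset_join]) ?_ ?_
    (fun _ _ => rfl)
  · intro σ _ σ' _ hσ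
    have h1 : α.1 ∪ σ.1 = α.1 ∪ σ'.1 := congrArg Subtype.val hσ
    apply Subtype.ext
    exact subset_antisymm ((union_subset_union_iff (X.link_disjoint α σ)).mp h1.subset)
      ((union_subset_union_iff (X.link_disjoint α σ')).mp h1.superset)
  · intro τ hτ
    have hτ' : α.1 ⊆ τ.1 := by simpa using hτ
    refine ⟨⟨τ.1 \ α.1, ?_⟩, mem_univ _, ?_⟩
    · have hc := τ.card_eq
      have hc' := α.card_eq
      refine mem_filter.mpr ⟨?_, by rw [card_sdiff_of_subset hτ']; omega⟩
      simp only [link, mem_image, mem_filter]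
      exact ⟨τ.1, ⟨τ.mem, hτ'⟩, rfl⟩
    · exact Subtype.ext (union_sdiff_of_subset hτ')

theorem link_prob (X : WeightedComplex U n) {j : ℕ} (α : X.Face j) {σ : Finset U}
    (hσ : Disjoint σ α.1) : (X.linkAt α).prob σ = X.prob (α.1 ∪ σ) / X.prob α.1 := by
  have hn : j + (n - α.1.card) = n := by
    have := α.le_rank
    rw [α.card_eq]; omega
  rw [prob_eq_sum_weight, X.prob_eq_sum_weight (α.1 ∪ σ), sum_div]
  have := X.sum_join α hn
    (fun ω => (if α.1 ∪ σ ⊆ ω.1 then X.weight ω.1 else 0) / X.prob α.1)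
  calc _ = _ := sum_congr rfl fun ω _ => ?_
    _ = _ := this
    _ = _ := sum_congr rfl fun ω _ => ?_
  · simp only [join, union_subset_union_iff hσ]
    split_ifs
    · rfl
    · simp
  · split_ifs with h1 h2 h2
    · rfl
    · rfl
    · exact absurd (subset_union_left.trans h2) h1
    · simp

theorem link_prob_face (X : WeightedComplex U n) {j k m : ℕ} (α : X.Face j) (h : j + k = m)
    (σ : (X.linkAt α).Face k) :
    (X.linkAt α).prob σ.1 = X.prob (X.join α h σ).1 / X.prob α.1 :=
  X.link_prob α (X.link_disjoint α σ)

/-- The level distributions of the link are rows of the up-walk of `X`, so expectations, entropies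
and variances in links are conditional ones in `X`. -/
theorem link_level (X : WeightedComplex U n) {j k m : ℕ} (α : X.Face j) (h : j + k = m)
    (σ : (X.linkAt α).Face k) : (X.linkAt α).level k σ = X.up j m α (X.join α h σ) := by
  rw [level, up, if_pos (X.subset_join α h σ), X.link_prob_face α h, α.card_eq,
    show m - j = k by omega]

theorem expect_link (X : WeightedComplex U n) {j k m : ℕ} (α : X.Face j) (h : j + k = m)
    (f : X.Face m → ℝ) :
    expect ((X.linkAt α).level k) (fun σ => f (X.join α h σ)) = expect (X.up j m α) f := by
  have := X.sum_join α h (fun τ => X.up j m α τ * f τ)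
  simp only [FinProb.expect, X.link_level α h]
  rw [this]
  refine sum_congr rfl fun τ _ => ?_
  split_ifs with h1
  · rfl
  · rw [up, if_neg h1, zero_mul]

theorem ent_link (X : WeightedComplex U n) {j k m : ℕ} (α : X.Face j) (h : j + k = m)
    (f : X.Face m → ℝ) :
    ent ((X.linkAt α).level k) (fun σ => f (X.join α h σ)) = ent (X.up j m α) f := by
  rw [ent, ent, X.expect_link α h, X.expect_link α h (fun τ => f τ * Real.log (f τ))]

theorem var_link (X : WeightedComplex U n) {j k m : ℕ} (α : X.Face j) (h : j + k = m)
    (f : X.Face m → ℝ) :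
    var ((X.linkAt α).level k) (fun σ => f (X.join α h σ)) = var (X.up j m α) f := by
  rw [var, var, X.expect_link α h, X.expect_link α h (fun τ => f τ ^ 2)]

theorem link_up (X : WeightedComplex U n) {j a b a' b' : ℕ} (α : X.Face j) (ha : j + a = a')
    (hb : j + b = b') (σ : (X.linkAt α).Face a) (τ : (X.linkAt α).Face b) :
    (X.linkAt α).up a b σ τ = X.up a' b' (X.join α ha σ) (X.join α hb τ) := by
  have h1 : (X.join α ha σ).1 ⊆ (X.join α hb τ).1 ↔ σ.1 ⊆ τ.1 :=
    union_subset_union_iff (X.link_disjoint α σ)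
  have hα := (X.prob_face_pos α).ne'
  have hσ := (X.prob_face_pos (X.join α ha σ)).ne'
  have hc := α.card_eq
  rw [up, up, X.link_prob_face α ha, X.link_prob_face α hb]
  simp only [h1]
  rw [show n - α.1.card - a = n - a' by omega, show b - a = b' - a' by omega]
  split_ifs
  · congr 1
    field_simp
  · rfl

theorem link_up_mulVec (X : WeightedComplex U n) {j a b a' b' : ℕ} (α : X.Face j)
    (ha : j + a = a') (hb : j + b = b') (f : X.Face b' → ℝ) (σ : (X.linkAt α).Face a) :
    ((X.linkAt α).up a b).mulVec (fun τ => f (X.join α hb τ)) σ =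
      (X.up a' b').mulVec f (X.join α ha σ) := by
  have := X.sum_join α hb (fun τ => X.up a' b' (X.join α ha σ) τ * f τ)
  simp only [Matrix.mulVec, dotProduct, X.link_up α ha hb]
  rw [this]
  refine sum_congr rfl fun τ _ => ?_
  split_ifs with h1
  · rfl
  · rw [up, if_neg fun h => h1 ((X.subset_join α ha σ).trans h), zero_mul]

/-! ### Entropy contraction -/

/-- By the chain rule, the entropy lost under `U_{ℓ→k}` is exactly the averaged conditional entropy.
-/
theorem upEC_mul_ent_le (X : WeightedComplex U n) {ℓ k : ℕ} (hk : ℓ ≤ k) (hn : k ≤ n)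
    {f : X.Face k → ℝ} (hf : ∀ τ, 0 ≤ f τ) :
    X.upEC ℓ k * ent (X.level k) f ≤ expect (X.level ℓ) (fun α => ent (X.up ℓ k α) f) := by
  have h := (ent_mulVec_le_entRatio_mul (fun α => (X.level_pos α).le) (X.sum_level (hk.trans hn))
    X.up_nonneg (X.sum_up hk hn) (X.sum_level_mul_up hk hn) hf).1
  have h2 := ent_chain (X.sum_level_mul_up hk hn) f
  rw [upEC, entContraction]
  linarith

/-- The entropy contraction argument inside the link of `α`: its vertices correspond to the faces of
size `i + 1` above `α`, and conditioning on one gives the next row of the up-walk. -/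
theorem one_sub_lec_mul_ent_le (X : WeightedComplex U n) {i : ℕ} (hi : i < n) (α : X.Face i)
    {f : X.Face n → ℝ} (hf : ∀ τ, 0 ≤ f τ) :
    (1 - X.lec α) * ent (X.up i n α) f ≤
      expect (X.up i (i + 1) α) (fun β => ent (X.up (i + 1) n β) f) ∧ X.lec α ≤ 1 := by
  have hn : i + (n - α.1.card) = n := by rw [α.card_eq]; omega
  have h1 : 1 ≤ n - α.1.card := by rw [α.card_eq]; omega
  obtain ⟨h, h'⟩ := ent_mulVec_le_entRatio_mul (fun σ => ((X.linkAt α).level_pos σ).le)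
    ((X.linkAt α).sum_level h1) (X.linkAt α).up_nonneg ((X.linkAt α).sum_up h1 le_rfl)
    ((X.linkAt α).sum_level_mul_up h1 le_rfl) (f := fun τ => f (X.join α hn τ)) (fun τ => hf _)
  refine ⟨?_, h'⟩
  rw [X.ent_link α hn, funext (X.link_up_mulVec α rfl hn f),
    X.ent_link α (rfl : i + 1 = i + 1)] at h
  have h2 := ent_chain (μ := X.up i (i + 1) α) (ν := X.up i n α) (P := X.up (i + 1) n)
    (fun τ => by
      rw [← X.up_mul_up (Nat.le_succ i) hi le_rfl, Matrix.mul_apply]) f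
  rw [h2] at h ⊢
  rw [lec]
  linarith

/-- The average entropy of `f` conditioned on a random face of size `i`. -/
def avgEnt (X : WeightedComplex U n) (i : ℕ) (f : X.Face n → ℝ) : ℝ :=
  expect (X.level i) (fun α => ent (X.up i n α) f)

/-- The only face of size `0` is empty, so the entropy at that level vanishes in the chain rule. -/
theorem ent_le_avgEnt_zero (X : WeightedComplex U n) (f : X.Face n → ℝ) :
    ent (X.level n) f ≤ X.avgEnt 0 f := by
  have h := ent_chain (X.sum_level_mul_up (Nat.zero_le n) le_rfl) f
  have h0 : ∀ g : X.Face 0 → ℝ, ent (X.level 0) g = 0 := by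
    intro g
    have : Subsingleton (X.Face 0) := ⟨fun α β => Subtype.ext (by
      rw [card_eq_zero.mp α.card_eq, card_eq_zero.mp β.card_eq])⟩
    obtain ⟨α⟩ := X.face_nonempty (Nat.zero_le n)
    have hg : g = fun _ => g α := funext fun β => by rw [Subsingleton.elim β α]
    have hs := X.sum_level (Nat.zero_le n)
    rw [hg]
    simp only [ent, FinProb.expect, ← sum_mul, hs, one_mul, sub_self]
  rw [h, h0, add_zero, avgEnt]

theorem maxLec_le_one (X : WeightedComplex U n) {i : ℕ} (hi : i < n) : X.maxLec i ≤ 1 :=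
  Real.iSup_le (fun α => (X.one_sub_lec_mul_ent_le hi α (f := fun _ => 0) fun _ => le_rfl).2)
    zero_le_one

theorem one_sub_maxLec_mul_avgEnt_le (X : WeightedComplex U n) {i : ℕ} (hi : i < n)
    {f : X.Face n → ℝ} (hf : ∀ τ, 0 ≤ f τ) :
    (1 - X.maxLec i) * X.avgEnt i f ≤ X.avgEnt (i + 1) f := by
  have h := expect_of_vecMul (X.sum_level_mul_up (Nat.le_succ i) hi)
    (fun β => ent (X.up (i + 1) n β) f)
  rw [avgEnt, avgEnt, h, ← expect_const_mul]
  refine sum_le_sum fun α _ => mul_le_mul_of_nonneg_left ?_ (X.level_pos α).le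
  refine le_trans ?_ (X.one_sub_lec_mul_ent_le hi α hf).1
  refine mul_le_mul_of_nonneg_right ?_
    (ent_nonneg (X.up_nonneg α) (X.sum_up hi.le le_rfl α) hf)
  have := le_ciSup (Set.finite_range (fun α : X.Face i => X.lec α)).bddAbove α
  rw [maxLec]
  linarith

theorem prod_mul_ent_le_avgEnt (X : WeightedComplex U n) {ℓ : ℕ} (hℓ : ℓ ≤ n)
    {f : X.Face n → ℝ} (hf : ∀ τ, 0 ≤ f τ) :
    (∏ i ∈ range ℓ, (1 - X.maxLec i)) * ent (X.level n) f ≤ X.avgEnt ℓ f := by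
  induction ℓ with
  | zero => simpa using X.ent_le_avgEnt_zero f
  | succ i ih =>
    refine le_trans ?_ (X.one_sub_maxLec_mul_avgEnt_le hℓ hf)
    rw [prod_range_succ, mul_comm (∏ _ ∈ _, _), mul_assoc]
    exact mul_le_mul_of_nonneg_left (ih (by omega)) (sub_nonneg.mpr (X.maxLec_le_one hℓ))

/-! ### The local log-Sobolev inequalities -/

theorem minLinkProb_pos (X : WeightedComplex U n) {j k : ℕ} (h : j + k ≤ n) (α : X.Face j) :
    0 < X.minLinkProb α k := by
  have := (X.linkAt α).face_nonempty (j := k) (by rw [α.card_eq]; omega)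
  obtain ⟨τ, hτ⟩ := exists_eq_ciInf_of_finite (f := fun τ => (X.linkAt α).level k τ)
  rw [minLinkProb, ← hτ]
  exact (X.linkAt α).level_pos τ

theorem minC_nonneg (X : WeightedComplex U n) {j k : ℕ} (h : j + k ≤ n) : 0 ≤ X.minC j k :=
  Real.iInf_nonneg fun α => (lsFun_pos (X.minLinkProb_pos h α)).le

/-- This is the complete-graph inequality in the link of `α`, transported to `X`. -/
theorem lsFun_mul_ent_up_le (X : WeightedComplex U n) {j k m : ℕ} (h : j + k = m) (hn : m ≤ n)
    (α : X.Face j) {f : X.Face m → ℝ} (hf : ∀ τ, 0 ≤ f τ) :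
    lsFun (X.minLinkProb α k) * ent (X.up j m α) (fun τ => f τ ^ 2) ≤ var (X.up j m α) f := by
  have := lsDefect_nonneg (μ := (X.linkAt α).level k) (f := fun σ => f (X.join α h σ))
    ((X.linkAt α).sum_level (by rw [α.card_eq]; omega)) (X.minLinkProb_pos (by omega) α)
    (fun τ => ciInf_le (Set.finite_range _).bddBelow τ) (fun σ => hf _)
  rw [lsDefect, X.var_link α h, X.ent_link α h (fun τ => f τ ^ 2)] at this
  linarith

theorem minC_mul_expect_ent_le (X : WeightedComplex U n) {j k m : ℕ} (h : j + k = m) (hn : m ≤ n)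
    {f : X.Face m → ℝ} (hf : ∀ τ, 0 ≤ f τ) :
    X.minC j k * expect (X.level j) (fun α => ent (X.up j m α) (fun τ => f τ ^ 2)) ≤
      expect (X.level j) (fun α => var (X.up j m α) f) := by
  rw [← expect_const_mul]
  refine sum_le_sum fun α _ => mul_le_mul_of_nonneg_left ?_ (X.level_pos α).le
  refine le_trans (mul_le_mul_of_nonneg_right ?_ ?_) (X.lsFun_mul_ent_up_le h hn α hf)
  · exact ciInf_le (f := fun α : X.Face j => lsFun (X.minLinkProb α k))
      (Set.finite_range _).bddBelow α
  · exact ent_nonneg (X.up_nonneg α) (X.sum_up (by omega) hn α) fun τ => sq_nonneg _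

/-! ### Dirichlet forms -/

theorem expect_mul_down_mulVec (X : WeightedComplex U n) {ℓ k : ℕ} (hk : ℓ ≤ k) (hn : k ≤ n)
    (f : X.Face k → ℝ) (g : X.Face ℓ → ℝ) :
    expect (X.level k) (fun τ => f τ * (X.down k ℓ).mulVec g τ) =
      expect (X.level ℓ) (fun α => (X.up ℓ k).mulVec f α * g α) := by
  simp only [FinProb.expect, Matrix.mulVec, dotProduct, mul_sum, sum_mul]
  rw [sum_comm]
  refine sum_congr rfl fun α _ => sum_congr rfl fun τ _ => ?_
  linear_combination -f τ * g α * X.level_mul_up hk hn α τ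

/-- By adjointness `⟨f, D U f⟩ = E (U f)²`, and `E f² - E (U f)²` is the averaged conditional
variance. -/
theorem dirichlet_downUp (X : WeightedComplex U n) {ℓ : ℕ} (hℓ : ℓ ≤ n) (f : X.Face n → ℝ) :
    dirichlet (X.level n) (X.downUp ℓ) f =
      expect (X.level ℓ) (fun α => var (X.up ℓ n α) f) := by
  have h1 := X.expect_mul_down_mulVec hℓ le_rfl f ((X.up ℓ n).mulVec f)
  have h2 := expect_of_vecMul (X.sum_level_mul_up hℓ le_rfl) (fun τ => f τ ^ 2)
  rw [Matrix.mulVec_mulVec] at h1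
  calc _ = expect (X.level n) (fun τ => f τ ^ 2) -
      expect (X.level n) (fun τ => f τ * (X.downUp ℓ).mulVec f τ) := by
        rw [dirichlet]
        simp only [FinProb.expect, ← sum_sub_distrib]
        exact sum_congr rfl fun τ _ => by ring
    _ = _ := by
        rw [downUp, h1, h2]
        simp only [FinProb.expect, ← sum_sub_distrib, var]
        refine sum_congr rfl fun α _ => ?_
        simp only [Matrix.mulVec, dotProduct]
        ring

/-! ### Link graphs and the up-down walk -/

theorem sum_prob_union_vertex (X : WeightedComplex U n) (x : Finset U) :
    ∑ y : X.Face 1, X.prob (x ∪ y.1) = n * X.prob x := by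
  have h : ∀ y : X.Face 1, X.prob (x ∪ y.1) = ∑ ω : X.Face n,
      (if x ⊆ ω.1 then X.prob ω.1 else 0) * if y.1 ⊆ ω.1 then (1 : ℝ) else 0 := by
    intro y
    rw [prob_eq_sum]
    refine sum_congr rfl fun ω _ => ?_
    simp only [union_subset_iff, ite_and]
    split_ifs <;> simp
  simp only [h]
  rw [sum_comm, X.prob_eq_sum x, mul_sum]
  refine sum_congr rfl fun ω _ => ?_
  have := X.sum_face_between (α := ∅) ω.mem (k := 1) (by simp)
  simp only [empty_subset, if_true, card_empty, Nat.sub_zero, ω.card_eq, Nat.choose_one_right]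
    at this
  rw [← mul_sum, this, mul_comm]

theorem sum_vertexWalk (X : WeightedComplex U n) (hn : 2 ≤ n) (x : X.Face 1) :
    ∑ y, X.vertexWalk x y = 1 := by
  have h := X.sum_prob_union_vertex x.1
  rw [← add_sum_erase _ _ (mem_univ x), union_self] at h
  rw [← add_sum_erase _ _ (mem_univ x), vertexWalk, if_pos rfl, zero_add]
  have e : ∀ y ∈ univ.erase x, X.vertexWalk x y =
      X.prob (x.1 ∪ y.1) / X.prob x.1 / ((n : ℝ) - 1) := fun y hy => by
    rw [vertexWalk, if_neg (ne_of_mem_erase hy).symm]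
  rw [sum_congr rfl e, ← sum_div, ← sum_div, div_div, div_eq_one_iff_eq]
  · linarith
  · have : (2 : ℝ) ≤ n := by exact_mod_cast hn
    exact mul_ne_zero (X.prob_face_pos x).ne' (by linarith)

theorem level_mul_vertexWalk (X : WeightedComplex U n) (x y : X.Face 1) :
    X.level 1 x * X.vertexWalk x y =
      if x = y then 0 else X.prob (x.1 ∪ y.1) / n / ((n : ℝ) - 1) := by
  rw [level, vertexWalk, Nat.choose_one_right]
  have := (X.prob_face_pos x).ne'
  split_ifs
  · simp
  · rw [div_mul_eq_mul_div, div_right_comm (X.prob (x.1 ∪ y.1)), mul_div_cancel₀ _ this,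
      div_right_comm]

theorem dirichlet_vertexWalk_nonneg (X : WeightedComplex U n) (hn : 2 ≤ n) (f : X.Face 1 → ℝ) :
    0 ≤ dirichlet (X.level 1) X.vertexWalk f := by
  refine dirichlet_nonneg (fun x y => ?_) (fun x y => ?_) (X.sum_vertexWalk hn) f
  · rw [level_mul_vertexWalk]
    have : (2 : ℝ) ≤ n := by exact_mod_cast hn
    have := X.prob_nonneg (x.1 ∪ y.1)
    split_ifs
    · exact le_rfl
    · exact div_nonneg (div_nonneg this (by linarith)) (by linarith)
  · simp only [level_mul_vertexWalk, union_comm, eq_comm (a := x)]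

/-- If `β ∪ β'` lies in a top face, it has size `n`, so `β ∩ β'` has size `n - 2` and is the only
common face of that size. Otherwise both sides vanish. -/
theorem prob_union_mul_count (X : WeightedComplex U n) {j m : ℕ} (hm : j + 1 = m) (hn : j + 2 = n)
    {β β' : X.Face m} (hβ : β ≠ β') :
    X.prob (β.1 ∪ β'.1) * (∑ α : X.Face j, if α.1 ⊆ β.1 then
      (if α.1 ⊆ β'.1 then (1 : ℝ) else 0) else 0) = X.prob (β.1 ∪ β'.1) := by
  rcases eq_or_ne (X.prob (β.1 ∪ β'.1)) 0 with h | h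
  · simp [h]
  obtain ⟨ω, hω⟩ := X.exists_top_of_prob_ne_zero h
  have h1 : (β.1 ∪ β'.1).card ≤ n := (card_le_card hω).trans ω.card_eq.le
  have h2 := card_union_add_card_inter β.1 β'.1
  have h3 : (β.1 ∩ β'.1).card < β.1.card := by
    refine card_lt_card (Finset.ssubset_iff_subset_ne.mpr ⟨inter_subset_left, fun h => hβ ?_⟩)
    refine Subtype.ext (eq_of_subset_of_card_le (inter_eq_left.mp h) ?_)
    rw [β.card_eq, β'.card_eq]
  rw [β.card_eq] at h3
  rw [β.card_eq, β'.card_eq] at h2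
  have h4 : (β.1 ∩ β'.1).card = j := by omega
  have h5 := X.sum_face_between (α := ∅)
    (X.down_closed _ β.mem _ (inter_subset_left (s₂ := β'.1))) (k := j) (by simp)
  simp only [empty_subset, if_true, card_empty, Nat.sub_zero, h4, Nat.choose_self, subset_inter_iff,
    ite_and, Nat.cast_one] at h5
  rw [h5, mul_one]

theorem upDown_apply (X : WeightedComplex U n) {ℓ : ℕ} (β β' : X.Face ℓ) :
    X.upDown ℓ β β' = X.prob (β.1 ∪ β'.1) / X.prob β.1 / (n.choose ℓ : ℝ) := by
  rw [upDown, Matrix.mul_apply, prob_eq_sum, sum_div, sum_div]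
  refine sum_congr rfl fun ω _ => ?_
  rw [up, down, Nat.choose_self]
  simp only [union_subset_iff, ite_and]
  split_ifs <;> simp [div_eq_mul_inv]

/-- The average over the faces of corank two of the Dirichlet forms of the link graphs is the
Dirichlet form of the up-down walk, up to a factor. -/
theorem expect_dirichlet_link (X : WeightedComplex U n) {j m : ℕ} (hm : j + 1 = m)
    (hn : j + 2 = n) (f : X.Face m → ℝ) :
    expect (X.level j) (fun α => dirichlet ((X.linkAt α).level 1) (X.linkAt α).vertexWalk
      (fun σ => f (X.join α hm σ))) * (((n : ℝ) - 1) / n) =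
      dirichlet (X.level m) (X.upDown m) f := by
  set W : X.Face m → X.Face m → ℝ := fun β β' =>
    if β = β' then 0 else X.prob (β.1 ∪ β'.1) * (f β * f β') with hW
  have hn' : (n : ℝ) = j + 2 := by rw [← hn]; push_cast; ring
  have hcm : (n.choose m : ℝ) = n := by
    rw [show m = n - 1 by omega, Nat.choose_symm (by omega), Nat.choose_one_right]
  have hcj : (n.choose j : ℝ) = n * (n - 1) / 2 := by
    rw [show j = n - 2 by omega, Nat.choose_symm (by omega), Nat.cast_choose_two]
  have hj0 : (0 : ℝ) ≤ j := Nat.cast_nonneg j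
  -- The factor `n (n - 1)` combines `binom(n, 2)` from `π_{n-2}` with the `2` from the level
  -- distribution of a link of rank two.
  have hloc : ∀ α : X.Face j, X.level j α * dirichlet ((X.linkAt α).level 1)
      (X.linkAt α).vertexWalk (fun σ => f (X.join α hm σ)) =
      X.level j α * (X.up j m).mulVec (fun τ => f τ ^ 2) α - (∑ β, ∑ β', W β β' *
        if α.1 ⊆ β.1 then (if α.1 ⊆ β'.1 then (1 : ℝ) else 0) else 0) / (n * (n - 1)) := by
    intro α
    have hα := (X.prob_face_pos α).ne'
    have hr : ((n - α.1.card : ℕ) : ℝ) = 2 := by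
      rw [α.card_eq, show n - j = 2 by omega]; norm_num
    have h1 := X.expect_link α hm (fun τ => f τ ^ 2)
    have h2 : ∀ x y : (X.linkAt α).Face 1, (X.linkAt α).level 1 x * (X.linkAt α).vertexWalk x y *
        (f (X.join α hm x) * f (X.join α hm y)) =
        W (X.join α hm x) (X.join α hm y) / X.prob α.1 / 2 := by
      intro x y
      have hinj : X.join α hm x = X.join α hm y ↔ x = y := by
        refine ⟨fun h => ?_, fun h => by rw [h]⟩
        have h' : α.1 ∪ x.1 = α.1 ∪ y.1 := congrArg Subtype.val h
        exact Subtype.ext (subset_antisymm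
          ((union_subset_union_iff (X.link_disjoint α x)).mp h'.subset)
          ((union_subset_union_iff (X.link_disjoint α y)).mp h'.superset))
      have hu : α.1 ∪ (x.1 ∪ y.1) = (X.join α hm x).1 ∪ (X.join α hm y).1 :=
        union_union_distrib_left _ _ _
      rw [level_mul_vertexWalk, hr, X.link_prob α
        (disjoint_union_left.mpr ⟨X.link_disjoint α x, X.link_disjoint α y⟩), hu]
      simp only [hW, hinj]
      split_ifs
      · simp
      · ring
    rw [dirichlet_eq]
    simp only [h2]
    have h3 : ∀ x : (X.linkAt α).Face 1, ∑ y, W (X.join α hm x) (X.join α hm y) / X.prob α.1 / 2 =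
        ∑ β', if α.1 ⊆ β'.1 then W (X.join α hm x) β' / X.prob α.1 / 2 else 0 := fun x =>
      X.sum_join α hm (fun β' => W (X.join α hm x) β' / X.prob α.1 / 2)
    have h4 := X.sum_join α hm (fun β => ∑ β', if α.1 ⊆ β'.1 then
      W β β' / X.prob α.1 / 2 else 0)
    have h5 : ∑ x : (X.linkAt α).Face 1, (X.linkAt α).level 1 x * f (X.join α hm x) ^ 2 =
      (X.up j m).mulVec (fun τ => f τ ^ 2) α := h1
    simp only [h3]
    rw [h4, h5, mul_sub, mul_sum, sum_div]
    congr 1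
    refine sum_congr rfl fun β _ => ?_
    split_ifs
    · rw [mul_sum, sum_div]
      refine sum_congr rfl fun β' _ => ?_
      split_ifs
      · rw [level, hcj]
        have : (n : ℝ) - 1 ≠ 0 := by rw [hn']; linarith
        have : (n : ℝ) ≠ 0 := by rw [hn']; linarith
        field_simp
      · simp
    · simp
  have hcount : ∑ α : X.Face j, ∑ β, ∑ β', (W β β' *
      if α.1 ⊆ β.1 then (if α.1 ⊆ β'.1 then (1 : ℝ) else 0) else 0) = ∑ β, ∑ β', W β β' := by
    rw [sum_comm]
    refine sum_congr rfl fun β _ => ?_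
    rw [sum_comm]
    refine sum_congr rfl fun β' _ => ?_
    rw [← mul_sum]
    simp only [hW]
    split_ifs with h
    · simp
    · linear_combination f β * f β' * X.prob_union_mul_count hm hn h
  -- The up-down walk stays put with probability `1 / n`; off the diagonal, the level and the walk
  -- each contribute a factor `1 / n`.
  have hUD : ∑ β, ∑ β', X.level m β * X.upDown m β β' * (f β * f β') =
      (∑ β, X.level m β * f β ^ 2) / n + (∑ β, ∑ β', W β β') / n ^ 2 := by
    rw [sum_div, sum_div, ← sum_add_distrib]
    refine sum_congr rfl fun β _ => ?_
    have hβ := (X.prob_face_pos β).ne'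
    rw [← add_sum_erase _ _ (mem_univ β), ← add_sum_erase univ (W β) (mem_univ β),
      upDown_apply, union_self, level, hcm]
    have hz : W β β = 0 := if_pos rfl
    rw [hz, zero_add, sum_div]
    congr 1
    · rw [div_self hβ]; ring
    · refine sum_congr rfl fun β' hβ' => ?_
      have : W β β' = X.prob (β.1 ∪ β'.1) * (f β * f β') := if_neg (ne_of_mem_erase hβ').symm
      rw [this, upDown_apply, hcm]
      field_simp
  rw [dirichlet_eq, hUD, FinProb.expect]
  simp only [hloc, sum_sub_distrib]
  rw [← sum_div, hcount]
  have h6 := expect_of_vecMul (X.sum_level_mul_up (show j ≤ m by omega) (show m ≤ n by omega))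
    (fun τ => f τ ^ 2)
  rw [FinProb.expect, FinProb.expect] at h6
  rw [← h6]
  have : (n : ℝ) - 1 ≠ 0 := by rw [hn']; linarith
  have : (n : ℝ) ≠ 0 := by rw [hn']; linarith
  field_simp
  ring

theorem minGap_mul_expect_var_le (X : WeightedComplex U n) {j m : ℕ} (hm : j + 1 = m)
    (hn : j + 2 = n) (f : X.Face m → ℝ) :
    X.minGap j * expect (X.level j) (fun α => var (X.up j m α) f) ≤
      expect (X.level j) (fun α => dirichlet ((X.linkAt α).level 1) (X.linkAt α).vertexWalk
        (fun σ => f (X.join α hm σ))) := by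
  rw [← expect_const_mul]
  refine sum_le_sum fun α _ => mul_le_mul_of_nonneg_left ?_ (X.level_pos α).le
  have hr : 2 ≤ n - α.1.card := by rw [α.card_eq]; omega
  have hs := (X.linkAt α).sum_level (k := 1) (by omega)
  have hp := fun σ => ((X.linkAt α).level_pos (k := 1) σ).le
  beta_reduce
  rw [← X.var_link α hm]
  refine le_trans (mul_le_mul_of_nonneg_right ?_ (var_nonneg hp hs _))
    (gap_mul_var_le hp hs ((X.linkAt α).dirichlet_vertexWalk_nonneg hr) _)
  exact ciInf_le (f := fun α : X.Face j => X.linkGap α) (Set.finite_range _).bddBelow α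

theorem minGap_nonneg (X : WeightedComplex U n) {j : ℕ} (hn : j + 2 = n) : 0 ≤ X.minGap j :=
  Real.iInf_nonneg fun α => by
    have hr : 2 ≤ n - α.1.card := by rw [α.card_eq]; omega
    exact gap_nonneg (fun σ => ((X.linkAt α).level_pos σ).le)
      ((X.linkAt α).sum_level (by omega)) ((X.linkAt α).dirichlet_vertexWalk_nonneg hr)

end WeightedComplex

end

/-! ### Assembly of the three bounds -/

theorem mainTheorem7 {U : Type*} [DecidableEq U] {n : ℕ} (X : WeightedComplex U n) :
    (∀ ℓ : ℕ, ℓ ≤ n →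
      ((X.minC ℓ (n - ℓ) * X.upEC ℓ n : ℝ) : EReal) ≤
        FinProb.logSobolev (X.level n) (X.downUp ℓ)) ∧
    (2 ≤ n →
      ((((n : ℝ) - 1) / n * X.minC (n - 2) 1 * X.minGap (n - 2) *
          X.upEC (n - 2) (n - 1) : ℝ) : EReal) ≤
        FinProb.logSobolev (X.level (n - 1)) (X.upDown (n - 1))) ∧
    (∀ ℓ : ℕ, ℓ ≤ n →
      ((X.minC ℓ (n - ℓ) * ∏ i ∈ Finset.range ℓ, (1 - X.maxLec i) : ℝ) : EReal) ≤
        FinProb.logSobolev (X.level n) (X.downUp ℓ)) := by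
  refine ⟨fun ℓ hℓ => ?_, fun hn => ?_, fun ℓ hℓ => ?_⟩
  · refine FinProb.le_logSobolev (fun τ => (X.level_pos τ).le) (X.sum_level le_rfl) fun f hf => ?_
    rw [X.dirichlet_downUp hℓ, mul_assoc]
    exact (mul_le_mul_of_nonneg_left (X.upEC_mul_ent_le hℓ le_rfl fun τ => sq_nonneg _)
      (X.minC_nonneg (by omega))).trans (X.minC_mul_expect_ent_le (by omega) le_rfl hf)
  · refine FinProb.le_logSobolev (fun τ => (X.level_pos τ).le) (X.sum_level (by omega))
      fun f hf => ?_
    have hm : n - 2 + 1 = n - 1 := by omega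
    have hn2 : n - 2 + 2 = n := by omega
    have hc := X.minC_nonneg (j := n - 2) (k := 1) (by omega)
    have hg := X.minGap_nonneg hn2
    have h1 := X.upEC_mul_ent_le (ℓ := n - 2) (k := n - 1) (f := fun τ => f τ ^ 2) (by omega)
      (by omega) fun τ => sq_nonneg _
    have h2 := X.minC_mul_expect_ent_le hm (by omega) hf
    have h3 := X.minGap_mul_expect_var_le hm hn2 f
    have hn1 : (2 : ℝ) ≤ n := by exact_mod_cast hn
    have hr : 0 ≤ ((n : ℝ) - 1) / n := div_nonneg (by linarith) (by linarith)
    rw [← X.expect_dirichlet_link hm hn2]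
    -- Chains entropy contraction, the log-Sobolev inequality and the gap in the links;
    -- nonnegativity of the constants lets the bounds be multiplied.
    have h4 := (mul_le_mul_of_nonneg_left ((mul_le_mul_of_nonneg_left h1 hc).trans h2) hg).trans h3
    calc _ = (X.minGap (n - 2) * (X.minC (n - 2) 1 * (X.upEC (n - 2) (n - 1) *
          FinProb.ent (X.level (n - 1)) fun τ => f τ ^ 2))) * (((n : ℝ) - 1) / n) := by ring
      _ ≤ _ := mul_le_mul_of_nonneg_right h4 hr
  -- The product is not compared with `EC(U_{ℓ→n})`: the telescoped entropy bound directly replaces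
  -- the contraction step of the first claim.
  · refine FinProb.le_logSobolev (fun τ => (X.level_pos τ).le) (X.sum_level le_rfl) fun f hf => ?_
    rw [X.dirichlet_downUp hℓ, mul_assoc]
    exact (mul_le_mul_of_nonneg_left (X.prod_mul_ent_le_avgEnt hℓ fun τ => sq_nonneg _)
      (X.minC_nonneg (by omega))).trans (X.minC_mul_expect_ent_le (by omega) le_rfl hf)
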